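/- **Lemma (integrable highest weight modules of $S(1,2,\alpha)$).** *The algebra.* Let $\alpha\in\mathbb{C}$ with $\alpha\neq 0$ and $\frac1\alpha\notin\mathbb{Z}$, and let $$A=(a_{ij})=\begin{pmatrix}2&-1&-1\\-1+\alpha&0&1\\-1-\alpha&1&0\end{pmatrix},\qquad p(1)=0,\quad p(2)=p(3)=1 .$$ Let $\mathfrak h$ be a complex vector space of dimension $6-\operatorname{rk}A$, with linearly independent $\alpha_1,\alpha_2,\alpha_3\in\mathfrak h^*$ and linearly independent $h_1,h_2,h_3\in\mathfrak h$ such that $\alpha_j(h_i)=a_{ij}$. Let $\bar{\mathfrak g}$ be the complex Lie superalgebra generated by the abelian even Lie algebra $\mathfrak h$ and by $X_i,Y_i$ ($i=1,2,3$) of parity $p(i)$, with relations $[h,X_i]=\alpha_i(h)X_i$, $[h,Y_i]=-\alpha_i(h)Y_i$, $[X_i,Y_j]=\delta_{ij}h_i$. Then $\mathfrak g=S(1,2,\alpha)$ is the quotient of $\bar{\mathfrak g}$ by its largest ideal that intersects $\mathfrak h$ trivially. For $\mu\in\mathfrak h^*$ put $\mathfrak g_\mu=\{x\in\mathfrak g\mid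 [h,x]=\mu(h)x \text{ for all } h\in\mathfrak h\}$; $\mu$ is a root if $\mu\ne0$ and $\mathfrak g_\mu\neq0$. *Real roots.* Starting from the base $(\alpha_i,h_i,p(i))_{i=1,2,3}$, one forms new bases by the following reflections, where at each step $a_{ij}=\alpha_j(h_i)$ is computed from the current base. * Even reflection at $k$, allowed if $a_{kk}\neq0$: $\alpha_i'=\alpha_i-\frac{2a_{ki}}{a_{kk}}\alpha_k$, $h_i'=h_i-\frac{2a_{ik}}{a_{kk}}h_k$, $p'=p$. * Odd reflection at $k$, allowed if $a_{kk}=0$, $p(k)=1$ and, for all $j\neq k$, $a_{kj}=0$ implies $a_{jk}=0$: $\alpha_k'=-\alpha_k$, $h_k'=h_k$, $p'(k)=p(k)$; for $i\neq k$ with $a_{ik}=a_{ki}=0$ nothing changes; for all other $i\ne k$, $\alpha_i'=\alpha_i+\alpha_k$, $h_i'=(-1)^{p(i)}(a_{ik}h_k+a_{ki}h_i)$, $p'(i)=p(i)+p(k)$. A root $\mu$ is *real* if $\mu$ or $\frac12\mu$ belongs to some base obtained from the initial one by a finite sequence of even and odd reflections. *Modules.* Modules are $\mathbb{Z}/2$-graded,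 and irreducible means nonzero without graded submodules other than $0$ and the whole module. Let $\mathfrak n_+$ be the subalgebra of $\mathfrak g$ generated by $X_1,X_2,X_3$. A $\mathfrak g$-module $V$ is a highest weight module with highest weight $\lambda\in\mathfrak h^*$ if it is generated by a nonzero vector $v$ with $\mathfrak n_+v=0$ and $hv=\lambda(h)v$ for all $h\in\mathfrak h$. Such a $V$ is *integrable* if, for every real root $\mu$, each $x\in\mathfrak g_\mu$ acts locally nilpotently on $V$ (for every $v\in V$ there is $N>0$ with $x^Nv=0$). *Statement.* Let $L(\lambda)$ be an irreducible highest weight module of $S(1,2,\alpha)$ with highest weight $\lambda\in\mathfrak h^*$, and put $\lambda_i=\lambda(h_i)$. 1. If $\lambda_2\neq0$ or $\lambda_3\neq0$, then $L(\lambda)$ is integrable if and only if $\lambda_1\in\mathbb{Z}_{\geq0}$ and $\lambda_2+\lambda_3-1\in\mathbb{Z}_{\geq0}$. 2. If $\lambda_2=\lambda_3=0$, then $L(\lambda)$ is integrable if and only if $\lambda_1\in\mathbb{Z}_{\geq0}$. -/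

import Mathlib

/-! Contragredient Lie superalgebras over `ℂ`, their modules, reflections of bases, real roots. -/

/-- The sign `(-1)^{ij}` for parities `i, j`. -/
def superSign (i j : ZMod 2) : ℂ := if i = 1 ∧ j = 1 then -1 else 1

/-- A (not necessarily associative or unital) `ℤ/2`-graded algebra structure on a complex vector
space `L`; the product is written as a bracket. -/
structure SuperAlgebra (L : Type*) [AddCommGroup L] [Module ℂ L] where
  bracket : L →ₗ[ℂ] L →ₗ[ℂ] L
  part : ZMod 2 → Submodule ℂ L
  isCompl_part : IsCompl (part 0) (part 1)
  bracket_mem : ∀ {i j : ZMod 2} {x y : L}, x ∈ part i → y ∈ part j →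
    bracket x y ∈ part (i + j)

/-- A Lie superalgebra structure on a complex vector space `L`: super skew-symmetry and the super
Jacobi identity hold for homogeneous elements. -/
structure LieSuperalgebra (L : Type*) [AddCommGroup L] [Module ℂ L] extends SuperAlgebra L where
  skew : ∀ {i j : ZMod 2} {x y : L}, x ∈ part i → y ∈ part j →
    bracket x y = -(superSign i j • bracket y x)
  jacobi : ∀ {i j k : ZMod 2} {x y z : L}, x ∈ part i → y ∈ part j → z ∈ part k →
    bracket x (bracket y z) = bracket (bracket x y) z + superSign i j • bracket y (bracket x z)

/-- A subspace `W` of a space `E` with a `ℤ/2`-grading `E = P 0 ⊕ P 1` is graded if it contains the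
homogeneous components of each of its elements. -/
def IsGradedSubspace {E : Type*} [AddCommGroup E] [Module ℂ E] (P : ZMod 2 → Submodule ℂ E)
    (W : Submodule ℂ E) : Prop :=
  ∀ a ∈ P 0, ∀ b ∈ P 1, a + b ∈ W → a ∈ W ∧ b ∈ W

namespace SuperAlgebra

variable {L : Type*} [AddCommGroup L] [Module ℂ L] (S : SuperAlgebra L)

/-- Graded two-sided ideals. -/
structure IsIdeal (I : Submodule ℂ L) : Prop where
  left : ∀ x : L, ∀ y ∈ I, S.bracket x y ∈ I
  right : ∀ x : L, ∀ y ∈ I, S.bracket y x ∈ I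
  graded : IsGradedSubspace S.part I

/-- The (graded, two-sided) ideal generated by a set. -/
def idealSpan (R : Set L) : Submodule ℂ L := sInf {I | S.IsIdeal I ∧ R ⊆ I}

theorem subset_idealSpan (R : Set L) : R ⊆ S.idealSpan R := by
  intro x hx
  simp only [idealSpan, SetLike.mem_coe, Submodule.mem_sInf]
  exact fun I hI => hI.2 hx

theorem isIdeal_idealSpan (R : Set L) : S.IsIdeal (S.idealSpan R) := by
  refine ⟨fun x y hy => ?_, fun x y hy => ?_, fun a ha b hb hab => ⟨?_, ?_⟩⟩ <;>
    simp only [idealSpan, Submodule.mem_sInf] at * <;> intro I hI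
  · exact hI.1.left x y (hy I hI)
  · exact hI.1.right x y (hy I hI)
  · exact (hI.1.graded a ha b hb (hab I hI)).1
  · exact (hI.1.graded a ha b hb (hab I hI)).2

theorem exists_add (x : L) : ∃ a ∈ S.part 0, ∃ b ∈ S.part 1, a + b = x := by
  have h : x ∈ S.part 0 ⊔ S.part 1 := by rw [S.isCompl_part.sup_eq_top]; trivial
  exact Submodule.mem_sup.1 h

theorem part_unique {a b a' b' : L} (ha : a ∈ S.part 0) (hb : b ∈ S.part 1)
    (ha' : a' ∈ S.part 0) (hb' : b' ∈ S.part 1) (h : a + b = a' + b') : a = a' ∧ b = b' := by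
  have h1 : a - a' = b' - b := by
    rw [sub_eq_sub_iff_add_eq_add, h, add_comm]
  have h0 : a - a' = 0 := by
    have hd := S.isCompl_part.disjoint
    rw [Submodule.disjoint_def] at hd
    exact hd _ (sub_mem ha ha') (h1 ▸ sub_mem hb' hb)
  have h2 : a = a' := sub_eq_zero.1 h0
  subst h2
  exact ⟨rfl, add_left_cancel h⟩

theorem isIdeal_sSup {C : Set (Submodule ℂ L)} (hC : ∀ I ∈ C, S.IsIdeal I) :
    S.IsIdeal (sSup C) := by
  have key : ∀ f : L →ₗ[ℂ] L, (∀ I ∈ C, ∀ y ∈ I, f y ∈ I) → ∀ y ∈ sSup C, f y ∈ sSup C := by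
    intro f hf y hy
    have : sSup C ≤ (sSup C).comap f :=
      sSup_le fun I hI y hy => (le_sSup hI : I ≤ sSup C) (hf I hI y hy)
    exact this hy
  refine ⟨fun x => key _ fun I hI y hy => (hC I hI).left x y hy,
    fun x => key (S.bracket.flip x) fun I hI y hy => (hC I hI).right x y hy, ?_⟩
  have hle : sSup C ≤ (sSup C ⊓ S.part 0) ⊔ (sSup C ⊓ S.part 1) := by
    refine sSup_le fun I hI x hx => ?_
    obtain ⟨a, ha, b, hb, rfl⟩ := S.exists_add x
    have hab := (hC I hI).graded a ha b hb hx
    have hIC : I ≤ sSup C := le_sSup hI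
    exact Submodule.add_mem_sup ⟨hIC hab.1, ha⟩ ⟨hIC hab.2, hb⟩
  intro a ha b hb hab
  obtain ⟨a', ha', b', hb', h⟩ := Submodule.mem_sup.1 (hle hab)
  obtain ⟨rfl, rfl⟩ := S.part_unique ha hb ha'.2 hb'.2 h.symm
  exact ⟨ha'.1, hb'.1⟩

/-- The quotient of a graded algebra by a graded ideal. -/
def quotient (I : Submodule ℂ L) (hI : S.IsIdeal I) : SuperAlgebra (L ⧸ I) where
  bracket := I.liftQ
    { toFun := fun x => I.mapQ I (S.bracket x) (fun y hy => hI.left x y hy)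
      map_add' := fun x y => by ext z; simp
      map_smul' := fun c x => by ext z; simp }
    (fun x hx => by
      rw [LinearMap.mem_ker]
      ext z
      simpa using hI.right z x hx)
  part := fun i => (S.part i).map I.mkQ
  isCompl_part := by
    constructor
    · rw [Submodule.disjoint_def]
      rintro _ ⟨a, ha, rfl⟩ ⟨b, hb, hab⟩
      have h : a + -b ∈ I := by
        rw [← sub_eq_add_neg]
        exact (Submodule.Quotient.eq I).1 hab.symm
      simpa using (hI.graded a ha (-b) (neg_mem hb) h).1
    · rw [codisjoint_iff, ← Submodule.map_sup, S.isCompl_part.sup_eq_top, Submodule.map_top,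
        Submodule.range_mkQ]
  bracket_mem := by
    rintro i j _ _ ⟨x, hx, rfl⟩ ⟨y, hy, rfl⟩
    exact ⟨S.bracket x y, S.bracket_mem hx hy, rfl⟩

end SuperAlgebra

namespace LieSuperalgebra

variable {L : Type*} [AddCommGroup L] [Module ℂ L] (𝔤 : LieSuperalgebra L)

/-- The quotient of a Lie superalgebra by a graded ideal. -/
def quotient (I : Submodule ℂ L) (hI : 𝔤.IsIdeal I) : LieSuperalgebra (L ⧸ I) where
  toSuperAlgebra := 𝔤.toSuperAlgebra.quotient I hI
  skew := by
    rintro i j _ _ ⟨x, hx, rfl⟩ ⟨y, hy, rfl⟩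
    exact congrArg I.mkQ (𝔤.skew hx hy)
  jacobi := by
    rintro i j k _ _ _ ⟨x, hx, rfl⟩ ⟨y, hy, rfl⟩ ⟨z, hz, rfl⟩
    exact congrArg I.mkQ (𝔤.jacobi hx hy hz)

/-- The subalgebra generated by a set, as a subspace. -/
def subalgebraSpan (R : Set L) : Submodule ℂ L :=
  sInf {W | R ⊆ W ∧ ∀ x ∈ W, ∀ y ∈ W, 𝔤.bracket x y ∈ W}

end LieSuperalgebra

/-! ### Free `ℤ/2`-graded algebras and Lie superalgebras given by generators and relations -/

section Presentation

variable {G : Type*} (p : G → ZMod 2)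

/-- The parity of a nonassociative word in generators of given parities. -/
def wordParity : FreeMagma G → ZMod 2
  | .of g => p g
  | .mul u v => wordParity u + wordParity v

/-- A nonassociative word as an element of the free nonassociative algebra. -/
noncomputable def word (w : FreeMagma G) : FreeNonUnitalNonAssocAlgebra ℂ G :=
  MonoidAlgebra.single w 1

theorem word_mul (u v : FreeMagma G) : word u * word v = word (u * v) := by
  simp [word, MonoidAlgebra.single_mul_single]

/-- The span of the words of parity `i`. -/
noncomputable def wordPart (i : ZMod 2) : Submodule ℂ (FreeNonUnitalNonAssocAlgebra ℂ G) :=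
  Submodule.span ℂ (word '' {w | wordParity p w = i})

theorem word_mem_wordPart (w : FreeMagma G) : word w ∈ wordPart p (wordParity p w) :=
  Submodule.subset_span ⟨w, rfl, rfl⟩

theorem wordPart_induction {i : ZMod 2} {f : FreeNonUnitalNonAssocAlgebra ℂ G → Prop}
    (h0 : f 0) (hadd : ∀ x y, f x → f y → f (x + y)) (hsmul : ∀ (c : ℂ) x, f x → f (c • x))
    (hw : ∀ w, wordParity p w = i → f (word w)) {x : FreeNonUnitalNonAssocAlgebra ℂ G}
    (hx : x ∈ wordPart p i) : f x := by
  induction hx using Submodule.span_induction with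
  | mem x hx => obtain ⟨w, hw', rfl⟩ := hx; exact hw w hw'
  | zero => exact h0
  | add x y _ _ hx hy => exact hadd x y hx hy
  | smul c x _ hx => exact hsmul c x hx

/-- The free nonassociative `ℤ/2`-graded algebra on generators of given parities. -/
noncomputable def freeSuperAlgebra : SuperAlgebra (FreeNonUnitalNonAssocAlgebra ℂ G) where
  bracket := LinearMap.mul ℂ _
  part := wordPart p
  isCompl_part := by
    have hsupp : ∀ i x, x ∈ wordPart p i → ∀ w, x.coeff w ≠ 0 → wordParity p w = i := by
      intro i x hx
      refine wordPart_induction p (f := fun x => ∀ w, x.coeff w ≠ 0 → wordParity p w = i)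
        ?_ ?_ ?_ ?_ hx
      · intro w hw; simp at hw
      · intro x y hx hy w hw
        by_cases h : x.coeff w = 0
        · exact hy w (by simpa [h] using hw)
        · exact hx w h
      · intro c x hx w hw
        exact hx w (by intro h; apply hw; simp [h])
      · intro w' hw' w hw
        by_cases h : w' = w
        · exact h ▸ hw'
        · exfalso; apply hw
          simp [word, Finsupp.single_eq_of_ne (Ne.symm h)]
    constructor
    · rw [Submodule.disjoint_def]
      intro x h0 h1
      ext w
      by_contra hne
      have e0 := hsupp 0 x h0 w hne
      have e1 := hsupp 1 x h1 w hne
      rw [e0] at e1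
      exact absurd e1 (by decide)
    · rw [codisjoint_iff, eq_top_iff]
      intro x _
      induction x using MonoidAlgebra.induction_linear with
      | zero => exact zero_mem _
      | add x y hx hy => exact add_mem (hx trivial) (hy trivial)
      | single w c =>
        have hc : (MonoidAlgebra.single w c : FreeNonUnitalNonAssocAlgebra ℂ G) = c • word w := by
          simp [word, MonoidAlgebra.smul_single]
        rw [hc]
        refine Submodule.smul_mem _ _ ?_
        have hw := word_mem_wordPart p w
        have h2 : ∀ i : ZMod 2, i = 0 ∨ i = 1 := by decide
        rcases h2 (wordParity p w) with h | h <;> rw [h] at hw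
        · exact Submodule.mem_sup_left hw
        · exact Submodule.mem_sup_right hw
  bracket_mem := by
    intro i j x y hx hy
    change x * y ∈ _
    refine wordPart_induction p (f := fun x => x * y ∈ wordPart p (i + j)) ?_ ?_ ?_ ?_ hx
    · rw [zero_mul]; exact zero_mem _
    · intro a b ha hb; rw [add_mul]; exact add_mem ha hb
    · intro c a ha; rw [smul_mul_assoc]; exact Submodule.smul_mem _ _ ha
    · intro u hu
      refine wordPart_induction p (f := fun y => word u * y ∈ wordPart p (i + j)) ?_ ?_ ?_ ?_ hy
      · rw [mul_zero]; exact zero_mem _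
      · intro a b ha hb; rw [mul_add]; exact add_mem ha hb
      · intro c a ha; rw [mul_smul_comm]; exact Submodule.smul_mem _ _ ha
      · intro v hv
        rw [word_mul, ← hu, ← hv]
        exact word_mem_wordPart p (u * v)

/-- The relators that express super skew-symmetry and the super Jacobi identity; as these
identities are multilinear, it suffices to impose them on words. -/
inductive IsLieRelator : FreeNonUnitalNonAssocAlgebra ℂ G → Prop
  | skew (u v : FreeMagma G) :
      IsLieRelator (word u * word v +
        superSign (wordParity p u) (wordParity p v) • (word v * word u))
  | jacobi (u v w : FreeMagma G) :
      IsLieRelator (word u * (word v * word w) - ((word u * word v) * word w +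
        superSign (wordParity p u) (wordParity p v) • (word v * (word u * word w))))

/-- The ideal of the free graded algebra generated by the Lie relators and a set `R`. -/
noncomputable def presentedIdeal (R : Set (FreeNonUnitalNonAssocAlgebra ℂ G)) :
    Submodule ℂ (FreeNonUnitalNonAssocAlgebra ℂ G) :=
  (freeSuperAlgebra p).idealSpan ({x | IsLieRelator p x} ∪ R)

theorem lieRelator_mem (R : Set (FreeNonUnitalNonAssocAlgebra ℂ G))
    {x : FreeNonUnitalNonAssocAlgebra ℂ G} (hx : IsLieRelator p x) : x ∈ presentedIdeal p R :=
  (freeSuperAlgebra p).subset_idealSpan _ (Or.inl hx)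

theorem presentedIdeal_skew (R : Set (FreeNonUnitalNonAssocAlgebra ℂ G)) {i j : ZMod 2}
    {x y : FreeNonUnitalNonAssocAlgebra ℂ G} (hx : x ∈ wordPart p i) (hy : y ∈ wordPart p j) :
    x * y + superSign i j • (y * x) ∈ presentedIdeal p R := by
  let F : FreeNonUnitalNonAssocAlgebra ℂ G →ₗ[ℂ] FreeNonUnitalNonAssocAlgebra ℂ G →ₗ[ℂ]
      FreeNonUnitalNonAssocAlgebra ℂ G :=
    LinearMap.mul ℂ _ + superSign i j • (LinearMap.mul ℂ _).flip
  change F x y ∈ presentedIdeal p R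
  refine wordPart_induction p (f := fun x => F x y ∈ presentedIdeal p R) ?_ ?_ ?_ ?_ hx
  · simp
  · intro a b ha hb; rw [map_add]; exact add_mem ha hb
  · intro c a ha; rw [map_smul]; exact Submodule.smul_mem _ _ ha
  · intro u hu
    refine wordPart_induction p (f := fun y => F (word u) y ∈ presentedIdeal p R) ?_ ?_ ?_ ?_ hy
    · simp
    · intro a b ha hb; rw [map_add]; exact add_mem ha hb
    · intro c a ha; rw [map_smul]; exact Submodule.smul_mem _ _ ha
    · intro v hv
      subst hu hv
      exact lieRelator_mem p R (IsLieRelator.skew u v)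

theorem presentedIdeal_jacobi (R : Set (FreeNonUnitalNonAssocAlgebra ℂ G)) {i j k : ZMod 2}
    {x y z : FreeNonUnitalNonAssocAlgebra ℂ G} (hx : x ∈ wordPart p i) (hy : y ∈ wordPart p j)
    (hz : z ∈ wordPart p k) :
    x * (y * z) - ((x * y) * z + superSign i j • (y * (x * z))) ∈ presentedIdeal p R := by
  refine wordPart_induction p (f := fun x => x * (y * z) - ((x * y) * z +
    superSign i j • (y * (x * z))) ∈ presentedIdeal p R) ?_ ?_ ?_ ?_ hx
  · simp
  · intro a b ha hb
    convert add_mem ha hb using 1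
    simp only [add_mul, mul_add, smul_add]; abel
  · intro c a ha
    convert Submodule.smul_mem _ c ha using 1
    simp only [smul_mul_assoc, mul_smul_comm, smul_add, smul_sub, smul_comm c]
  intro u hu
  refine wordPart_induction p (f := fun y => word u * (y * z) - ((word u * y) * z +
    superSign i j • (y * (word u * z))) ∈ presentedIdeal p R) ?_ ?_ ?_ ?_ hy
  · simp
  · intro a b ha hb
    convert add_mem ha hb using 1
    simp only [add_mul, mul_add, smul_add]; abel
  · intro c a ha
    convert Submodule.smul_mem _ c ha using 1
    simp only [smul_mul_assoc, mul_smul_comm, smul_add, smul_sub, smul_comm c]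
  intro v hv
  refine wordPart_induction p (f := fun z => word u * (word v * z) - ((word u * word v) * z +
    superSign i j • (word v * (word u * z))) ∈ presentedIdeal p R) ?_ ?_ ?_ ?_ hz
  · simp
  · intro a b ha hb
    convert add_mem ha hb using 1
    simp only [mul_add, smul_add]; abel
  · intro c a ha
    convert Submodule.smul_mem _ c ha using 1
    simp only [mul_smul_comm, smul_add, smul_sub, smul_comm c]
  intro w _
  subst hu hv
  exact lieRelator_mem p R (IsLieRelator.jacobi u v w)

/-- The Lie superalgebra with generators `G` of parities `p` and relators `R`. -/
noncomputable def presentedLieSuperalgebra (R : Set (FreeNonUnitalNonAssocAlgebra ℂ G)) :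
    LieSuperalgebra (FreeNonUnitalNonAssocAlgebra ℂ G ⧸ presentedIdeal p R) where
  toSuperAlgebra := (freeSuperAlgebra p).quotient _ ((freeSuperAlgebra p).isIdeal_idealSpan _)
  skew := by
    rintro i j _ _ ⟨x, hx, rfl⟩ ⟨y, hy, rfl⟩
    refine (Submodule.Quotient.eq _).2 ?_
    rw [sub_neg_eq_add]
    exact presentedIdeal_skew p R hx hy
  jacobi := by
    rintro i j k _ _ _ ⟨x, hx, rfl⟩ ⟨y, hy, rfl⟩ ⟨z, hz, rfl⟩
    exact (Submodule.Quotient.eq _).2 (presentedIdeal_jacobi p R hx hy hz)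

end Presentation

/-! ### Modules over a Lie superalgebra -/

/-- A module structure on a complex vector space `V` over a Lie superalgebra `𝔤`: a `ℤ/2`-grading
of `V` and a compatible action. -/
structure LieSuperalgebra.Rep {L : Type*} [AddCommGroup L] [Module ℂ L] (𝔤 : LieSuperalgebra L)
    (V : Type*) [AddCommGroup V] [Module ℂ V] where
  act : L →ₗ[ℂ] Module.End ℂ V
  part : ZMod 2 → Submodule ℂ V
  isCompl_part : IsCompl (part 0) (part 1)
  act_mem : ∀ {i j : ZMod 2} {x : L} {v : V}, x ∈ 𝔤.part i → v ∈ part j → act x v ∈ part (i + j)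
  act_bracket : ∀ {i j : ZMod 2} {x y : L}, x ∈ 𝔤.part i → y ∈ 𝔤.part j → ∀ v : V,
    act (𝔤.bracket x y) v = act x (act y v) - superSign i j • act y (act x v)

namespace LieSuperalgebra.Rep

variable {L : Type*} [AddCommGroup L] [Module ℂ L] {𝔤 : LieSuperalgebra L}
  {V : Type*} [AddCommGroup V] [Module ℂ V] (M : 𝔤.Rep V)

/-- Subspaces that are stable under the action. -/
def IsStable (W : Submodule ℂ V) : Prop := ∀ x : L, ∀ v ∈ W, M.act x v ∈ W

/-- Irreducibility: `V ≠ 0` and there are no graded submodules besides `0` and `V`. -/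
def IsIrreducible : Prop :=
  Nontrivial V ∧
    ∀ W : Submodule ℂ V, M.IsStable W → IsGradedSubspace M.part W → W = ⊥ ∨ W = ⊤

/-- An element acts locally nilpotently. -/
def IsLocallyNilpotent (x : L) : Prop := ∀ v : V, ∃ N : ℕ, 0 < N ∧ (M.act x ^ N) v = 0

end LieSuperalgebra.Rep

/-! ### Contragredient Lie superalgebras -/

/-- A realization `𝔥, αⱼ ∈ 𝔥*, hᵢ ∈ 𝔥` of a complex matrix `A`:
`dim 𝔥 = 2n - rk A`, both families are linearly independent, and `αⱼ(hᵢ) = aᵢⱼ`. -/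
structure Realization {n : ℕ} (A : Matrix (Fin n) (Fin n) ℂ) (H : Type*) [AddCommGroup H]
    [Module ℂ H] where
  root : Fin n → Module.Dual ℂ H
  coroot : Fin n → H
  finiteDimensional : FiniteDimensional ℂ H
  finrank_add_rank : Module.finrank ℂ H + A.rank = 2 * n
  linearIndependent_root : LinearIndependent ℂ root
  linearIndependent_coroot : LinearIndependent ℂ coroot
  root_coroot : ∀ i j, root j (coroot i) = A i j

/-- The generators `h ∈ 𝔥`, `X₁, …, Xₙ`, `Y₁, …, Yₙ`. -/
inductive ChevalleyGen (n : ℕ) (H : Type*) : Type _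
  | h (a : H) : ChevalleyGen n H
  | X (i : Fin n) : ChevalleyGen n H
  | Y (i : Fin n) : ChevalleyGen n H

/-- Elements of `𝔥` are even; `Xᵢ` and `Yᵢ` have parity `p i`. -/
def ChevalleyGen.parity {n : ℕ} {H : Type*} (p : Fin n → ZMod 2) : ChevalleyGen n H → ZMod 2
  | .h _ => 0
  | .X i => p i
  | .Y i => p i

namespace Realization

variable {n : ℕ} {A : Matrix (Fin n) (Fin n) ℂ} {H : Type*} [AddCommGroup H] [Module ℂ H]
  (R : Realization A H) (p : Fin n → ZMod 2)

/-- A generator as an element of the free nonassociative algebra. -/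
noncomputable def gen (g : ChevalleyGen n H) :
    FreeNonUnitalNonAssocAlgebra ℂ (ChevalleyGen n H) :=
  word (FreeMagma.of g)

/-- The relators of `𝔤̄(A)`; the first three say that `𝔥` is an abelian Lie algebra that is
mapped linearly. -/
inductive IsChevalleyRelator : FreeNonUnitalNonAssocAlgebra ℂ (ChevalleyGen n H) → Prop
  | add (a b : H) : IsChevalleyRelator (gen (.h (a + b)) - (gen (.h a) + gen (.h b)))
  | smul (c : ℂ) (a : H) : IsChevalleyRelator (gen (.h (c • a)) - c • gen (.h a))
  | hh (a b : H) : IsChevalleyRelator (gen (.h a) * gen (.h b))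
  | hX (a : H) (i : Fin n) :
      IsChevalleyRelator (gen (.h a) * gen (.X i) - R.root i a • gen (.X i))
  | hY (a : H) (i : Fin n) :
      IsChevalleyRelator (gen (.h a) * gen (.Y i) + R.root i a • gen (.Y i))
  | XY_same (i : Fin n) :
      IsChevalleyRelator (gen (.X i) * gen (.Y i) - gen (.h (R.coroot i)))
  | XY_ne (i j : Fin n) (hij : i ≠ j) : IsChevalleyRelator (gen (.X i) * gen (.Y j))

/-- The underlying space of `𝔤̄(A)`. -/
abbrev BarSpace : Type _ :=
  FreeNonUnitalNonAssocAlgebra ℂ (ChevalleyGen n H) ⧸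
    presentedIdeal (ChevalleyGen.parity p) {x | R.IsChevalleyRelator x}

/-- The Lie superalgebra `𝔤̄(A)` given by generators and relations. -/
noncomputable def bar : LieSuperalgebra (R.BarSpace p) :=
  presentedLieSuperalgebra (ChevalleyGen.parity p) {x | R.IsChevalleyRelator x}

/-- The generators in `𝔤̄(A)`. -/
noncomputable def barGen (g : ChevalleyGen n H) : R.BarSpace p := Submodule.Quotient.mk (gen g)

/-- The largest ideal of `𝔤̄(A)` that intersects `𝔥` trivially: the sum of all such ideals. -/
noncomputable def maxIdeal : Submodule ℂ (R.BarSpace p) :=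
  sSup {I | (R.bar p).IsIdeal I ∧ ∀ a : H, R.barGen p (.h a) ∈ I → R.barGen p (.h a) = 0}

theorem isIdeal_maxIdeal : (R.bar p).IsIdeal (R.maxIdeal p) :=
  (R.bar p).isIdeal_sSup fun _ hI => hI.1

/-- The underlying space of the contragredient Lie superalgebra `𝔤(A)`. -/
abbrev Space : Type _ := R.BarSpace p ⧸ R.maxIdeal p

/-- The contragredient Lie superalgebra `𝔤(A)`. -/
noncomputable def contragredient : LieSuperalgebra (R.Space p) :=
  (R.bar p).quotient (R.maxIdeal p) (R.isIdeal_maxIdeal p)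

/-- The image of `a ∈ 𝔥` in `𝔤(A)`. -/
noncomputable def h (a : H) : R.Space p := Submodule.Quotient.mk (R.barGen p (.h a))

/-- The generator `Xᵢ` of `𝔤(A)`. -/
noncomputable def X (i : Fin n) : R.Space p := Submodule.Quotient.mk (R.barGen p (.X i))

/-- The generator `Yᵢ` of `𝔤(A)`. -/
noncomputable def Y (i : Fin n) : R.Space p := Submodule.Quotient.mk (R.barGen p (.Y i))

/-- The subalgebra `𝔫₊` of `𝔤(A)` generated by the `Xᵢ`. -/
noncomputable def nPlus : Submodule ℂ (R.Space p) :=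
  (R.contragredient p).subalgebraSpan (Set.range (R.X p))

/-- The space `𝔤(A)_μ = {x | [a, x] = μ(a) x for all a ∈ 𝔥}`. -/
noncomputable def rootSpace (μ : Module.Dual ℂ H) : Submodule ℂ (R.Space p) :=
  ⨅ a : H, LinearMap.ker ((R.contragredient p).bracket (R.h p a) - μ a • LinearMap.id)

/-- Roots of `𝔤(A)`. -/
def IsRoot (μ : Module.Dual ℂ H) : Prop := μ ≠ 0 ∧ R.rootSpace p μ ≠ ⊥

end Realization

/-! ### Bases, even and odd reflections, real roots -/

/-- The data attached to a base: simple roots `αᵢ`, elements `hᵢ ∈ 𝔥`, and parities. -/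
structure BaseData (n : ℕ) (H : Type*) [AddCommGroup H] [Module ℂ H] where
  root : Fin n → Module.Dual ℂ H
  coroot : Fin n → H
  parity : Fin n → ZMod 2

namespace BaseData

variable {n : ℕ} {H : Type*} [AddCommGroup H] [Module ℂ H] (b : BaseData n H)

/-- The Cartan matrix `aᵢⱼ = αⱼ(hᵢ)` of a base (no normalization of its rows is imposed). -/
def cartan (i j : Fin n) : ℂ := b.root j (b.coroot i)

/-- The even reflection at `αₖ`, for `aₖₖ ≠ 0`. If `hₖ` is normalized so that `aₖₖ = 2`, this is
`αᵢ ↦ αᵢ - αᵢ(hₖ) αₖ` and `hᵢ ↦ hᵢ - αₖ(hᵢ) hₖ`. -/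
noncomputable def evenReflection (k : Fin n) : BaseData n H where
  root i := b.root i - (2 * b.cartan k i / b.cartan k k) • b.root k
  coroot i := b.coroot i - (2 * b.cartan i k / b.cartan k k) • b.coroot k
  parity := b.parity

/-- The simple root `αₖ` is isotropic. -/
def IsIsotropic (k : Fin n) : Prop := b.cartan k k = 0 ∧ b.parity k = 1

/-- The simple root `αₖ` is regular. -/
def IsRegular (k : Fin n) : Prop := ∀ j, j ≠ k → b.cartan k j = 0 → b.cartan j k = 0

open Classical in
/-- The odd reflection at a regular isotropic simple root `αₖ`. The formula for the new `hᵢ` is that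
of `[Xᵢ', Yᵢ']` with `Xᵢ' = [Xᵢ, Xₖ]` and `Yᵢ' = [Yᵢ, Yₖ]`. -/
noncomputable def oddReflection (k : Fin n) : BaseData n H where
  root i :=
    if i = k then -b.root k
    else if b.cartan i k = 0 ∧ b.cartan k i = 0 then b.root i
    else b.root i + b.root k
  coroot i :=
    if i = k then b.coroot k
    else if b.cartan i k = 0 ∧ b.cartan k i = 0 then b.coroot i
    else superSign (b.parity i) 1 • (b.cartan i k • b.coroot k + b.cartan k i • b.coroot i)
  parity i :=
    if i = k then b.parity k
    else if b.cartan i k = 0 ∧ b.cartan k i = 0 then b.parity i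
    else b.parity i + b.parity k

/-- `b.Reachable b'`: the base `b'` is obtained from `b` by a finite sequence of even and odd
reflections. -/
inductive Reachable : BaseData n H → Prop
  | refl : Reachable b
  | even {c : BaseData n H} (k : Fin n) : Reachable c → c.cartan k k ≠ 0 →
      Reachable (c.evenReflection k)
  | odd {c : BaseData n H} (k : Fin n) : Reachable c → c.IsIsotropic k → c.IsRegular k →
      Reachable (c.oddReflection k)

end BaseData

namespace Realization

variable {n : ℕ} {A : Matrix (Fin n) (Fin n) ℂ} {H : Type*} [AddCommGroup H] [Module ℂ H]
  (R : Realization A H) (p : Fin n → ZMod 2)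

/-- The standard base of `𝔤(A)`. -/
def base : BaseData n H := ⟨R.root, R.coroot, p⟩

/-- A root `μ` is real if `μ` or `μ / 2` is simple in some base obtained from the standard one by
even and odd reflections. -/
def IsRealRoot (μ : Module.Dual ℂ H) : Prop :=
  R.IsRoot p μ ∧ ∃ b : BaseData n H, (R.base p).Reachable b ∧
    ∃ i, μ = b.root i ∨ (1 / 2 : ℂ) • μ = b.root i

variable {V : Type*} [AddCommGroup V] [Module ℂ V] (M : (R.contragredient p).Rep V)

/-- Highest weight modules over `𝔤(A)` with highest weight `lam`. -/
def IsHighestWeight (lam : Module.Dual ℂ H) : Prop :=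
  ∃ v : V, v ≠ 0 ∧ (∀ x ∈ R.nPlus p, M.act x v = 0) ∧ (∀ a : H, M.act (R.h p a) v = lam a • v) ∧
    ∀ W : Submodule ℂ V, M.IsStable W → v ∈ W → W = ⊤

/-- Integrability: for each real root `μ`, the elements of `𝔤(A)_μ` are locally nilpotent. -/
def IsIntegrable : Prop :=
  ∀ μ : Module.Dual ℂ H, R.IsRealRoot p μ → ∀ x ∈ R.rootSpace p μ, M.IsLocallyNilpotent x

end Realization

/-! ### The Lie superalgebra `S(1,2,α)` -/

/-- The Cartan matrix of `S(1,2,α)`. -/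
def cartanS (α : ℂ) : Matrix (Fin 3) (Fin 3) ℂ :=
  !![2, -1, -1; -1 + α, 0, 1; -1 - α, 1, 0]

/-- The parities of the simple roots of `S(1,2,α)`: `α₁` is even, `α₂` and `α₃` are odd. -/
def parityS : Fin 3 → ZMod 2 := ![0, 1, 1]

/-! The indices 0, 1, 2 of the code are 1, 2, 3 in these comments. Two `sl₂`-triples govern
integrability: (X₁, Y₁, h₁) and (E, g, h₂ + h₃) with E = [X₂, X₃] and g = -[Y₂, Y₃] (`raiseOp`,
`lowOp`). Their roots α₁ and α₂ + α₃ add up to δ, and they pair with each other's coroots to -2, as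
in affine `sl₂`.

Necessity. The roots -α₁ and -(α₂ + α₃) are simple in suitable reflected bases, so Y₁ and g are
locally nilpotent. The vector v is primitive of weight λ₁ for the first triple. If λᵢ ≠ 0 for an odd
αᵢ, then Yᵢv is nonzero and primitive of weight λ₂ + λ₃ - 1 for the second. Local nilpotency forces
both weights to be natural numbers.

Sufficiency has two halves. The first shows that Y₁ and g are locally nilpotent
(`opY_zero_locallyNilpotent`, `lowOp_locallyNilpotent`). A power of the operator kills v or Yᵢv
because the result is a singular vector of lower weight (`lowOp_pow_eq_zero`), and Serre type
relations carry nilpotency to all of V. These relations are needed only for operators on V. They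
hold because an operator of negative weight that commutes with the Xᵢ up to scalars generates a
proper submodule (`eq_zero_of_weight_neg`).

The second half treats all real roots at once. The two triples give reflections that permute the
weights, and their products translate a root β by ±β(h₁)δ. Every root β of every reachable base
vanishes on h₁ + h₂ + h₃ and has β(h₁) a nonzero integer (`isAffineReal_of_reachable`), so β can be
moved to positive height. There weight strings are bounded because V has a highest weight, hence
β-strings are bounded and root vectors are nilpotent (`hasBoundedStrings_of_isAffineReal`). -/

/-! ### Elementary `sl₂`-theory for operators -/

section SlTwo

variable {V : Type*} [AddCommGroup V] [Module ℂ V]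

/-- Operators that satisfy the relations of `sl₂`. -/
structure IsSlTwoOps (e f h : Module.End ℂ V) : Prop where
  he : ∀ w, h (e w) = e (h w) + (2 : ℂ) • e w
  hf : ∀ w, h (f w) = f (h w) - (2 : ℂ) • f w
  ef : ∀ w, e (f w) = f (e w) + h w

namespace IsSlTwoOps

variable {e f h : Module.End ℂ V}

theorem symm (T : IsSlTwoOps e f h) : IsSlTwoOps f e (-h) where
  he w := by simp only [LinearMap.neg_apply, T.hf, map_neg]; module
  hf w := by simp only [LinearMap.neg_apply, T.he, map_neg]; module
  ef w := by simp only [LinearMap.neg_apply, T.ef]; module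

theorem h_pow_f (T : IsSlTwoOps e f h) {m : ℂ} {w : V} (hw : h w = m • w) (n : ℕ) :
    h ((f ^ n) w) = (m - 2 * n) • (f ^ n) w := by
  induction n with
  | zero => simpa using hw
  | succ n ih =>
    rw [pow_succ', Module.End.mul_apply, T.hf, ih, map_smul]
    push_cast
    module

theorem h_pow_e (T : IsSlTwoOps e f h) {m : ℂ} {w : V} (hw : h w = m • w) (n : ℕ) :
    h ((e ^ n) w) = (m + 2 * n) • (e ^ n) w := by
  have h1 := T.symm.h_pow_f (m := -m) (w := w) (by simp [hw]) n
  rw [LinearMap.neg_apply, neg_eq_iff_eq_neg] at h1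
  rw [h1]
  module

theorem e_pow_succ_f (T : IsSlTwoOps e f h) {m : ℂ} {w : V} (hw : h w = m • w) (he : e w = 0)
    (n : ℕ) : e ((f ^ (n + 1)) w) = ((n + 1) * (m - n)) • (f ^ n) w := by
  induction n with
  | zero => simp [T.ef, he, hw]
  | succ n ih =>
    rw [pow_succ', Module.End.mul_apply, T.ef, ih, map_smul, ← Module.End.mul_apply, ← pow_succ',
      T.h_pow_f hw]
    push_cast
    module

/-- If n + 1 is the least exponent that kills w, applying e to f^(n+1) w = 0 gives (n + 1)(m - n)
f^n w = 0 with f^n w ≠ 0. -/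
theorem exists_weight_eq_nat (T : IsSlTwoOps e f h) {m : ℂ} {w : V} (hw0 : w ≠ 0)
    (hw : h w = m • w) (he : e w = 0) (hf : ∃ N, (f ^ N) w = 0) :
    ∃ n : ℕ, m = n ∧ ∀ j ≤ n, (f ^ j) w ≠ 0 := by
  classical
  obtain ⟨n, hn⟩ : ∃ n, Nat.find hf = n + 1 := by
    refine Nat.exists_eq_succ_of_ne_zero fun h0 => hw0 ?_
    simpa [h0] using Nat.find_spec hf
  have hz := Nat.find_spec hf
  rw [hn] at hz
  have hmin : ∀ j ≤ n, (f ^ j) w ≠ 0 := fun j hj => Nat.find_min hf (by omega)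
  refine ⟨n, ?_, hmin⟩
  have h1 := T.e_pow_succ_f hw he n
  rw [hz, map_zero, eq_comm, smul_eq_zero, mul_eq_zero] at h1
  rcases h1 with (h1 | h1) | h1
  · exact absurd h1 (by exact_mod_cast n.succ_ne_zero)
  · exact sub_eq_zero.1 h1
  · exact absurd h1 (hmin n le_rfl)

/-- The last nonzero vector e^k w is primitive, so its weight z + 2k is a natural number n. For z ≥
0 the exponent z + k is at most n, so that power of f does not kill it and reaches weight -z.
Negative z is handled by exchanging e and f. -/
theorem exists_reflection_aux (T : IsSlTwoOps e f h) {m : ℂ} {w : V} (hw0 : w ≠ 0)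
    (hw : h w = m • w) (he : ∃ N, (e ^ N) w = 0) (hf : ∀ w, ∃ N, (f ^ N) w = 0) :
    ∃ (z : ℤ) (k : ℕ), m = z ∧ 0 ≤ z + 2 * k ∧ (0 ≤ z → (f ^ (z.toNat + k)) ((e ^ k) w) ≠ 0) := by
  classical
  obtain ⟨k, hk⟩ : ∃ n, Nat.find he = n + 1 := by
    refine Nat.exists_eq_succ_of_ne_zero fun h0 => hw0 ?_
    simpa [h0] using Nat.find_spec he
  have hz := Nat.find_spec he
  rw [hk, pow_succ', Module.End.mul_apply] at hz
  obtain ⟨n, hn, hj⟩ := T.exists_weight_eq_nat (Nat.find_min he (m := k) (by omega))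
    (T.h_pow_e hw k) hz (hf _)
  refine ⟨n - 2 * k, k, ?_, by omega, fun h0 => hj _ (by omega)⟩
  push_cast
  exact eq_sub_of_add_eq hn

/-- If `e` and `f` are locally nilpotent, then weights are integral and the reflected weight occurs:
some word in `e` and `f` of total weight `-m` does not kill a vector of weight `m`. -/
theorem exists_reflection (T : IsSlTwoOps e f h) {m : ℂ} {w : V} (hw0 : w ≠ 0)
    (hw : h w = m • w) (he : ∀ w, ∃ N, (e ^ N) w = 0) (hf : ∀ w, ∃ N, (f ^ N) w = 0) :
    ∃ a b : ℕ, m = (b : ℂ) - a ∧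
      ((f ^ b) ((e ^ a) w) ≠ 0 ∨ (e ^ a) ((f ^ b) w) ≠ 0) := by
  obtain ⟨z, k, hz, -, h1⟩ := T.exists_reflection_aux hw0 hw (he w) hf
  obtain ⟨z', k', hz', -, h2⟩ := T.symm.exists_reflection_aux (m := -m) hw0 (by simp [hw]) (hf w) he
  have hzz : z' = -z := by
    have : (z' : ℂ) = -z := by rw [← hz', hz]
    exact_mod_cast this
  rcases le_total 0 z with h0 | h0
  · refine ⟨k, z.toNat + k, ?_, Or.inl (h1 h0)⟩
    have : (z.toNat : ℂ) = z := by exact_mod_cast Int.toNat_of_nonneg h0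
    push_cast
    rw [this, hz]; ring
  · refine ⟨z'.toNat + k', k', ?_, Or.inr (h2 (by omega))⟩
    have : (z'.toNat : ℂ) = z' := by exact_mod_cast Int.toNat_of_nonneg (by omega : 0 ≤ z')
    push_cast
    rw [this, hzz, hz]; push_cast; ring

end IsSlTwoOps

/-- The subspace on which an operator is locally nilpotent. -/
def locallyNilpotentSubspace (f : Module.End ℂ V) : Submodule ℂ V where
  carrier := {w | ∃ N, (f ^ N) w = 0}
  zero_mem' := ⟨0, by simp⟩
  add_mem' := by
    rintro a b ⟨m, hm⟩ ⟨n, hn⟩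
    have ha : (f ^ (m + n)) a = 0 := by
      rw [add_comm, pow_add, Module.End.mul_apply, hm, map_zero]
    have hb : (f ^ (m + n)) b = 0 := by rw [pow_add, Module.End.mul_apply, hn, map_zero]
    exact ⟨m + n, by rw [map_add, ha, hb, add_zero]⟩
  smul_mem' := by
    rintro c a ⟨m, hm⟩
    exact ⟨m, by rw [map_smul, hm, smul_zero]⟩

theorem mem_locallyNilpotentSubspace {f : Module.End ℂ V} {w : V} :
    w ∈ locallyNilpotentSubspace f ↔ ∃ N, (f ^ N) w = 0 := Iff.rfl

theorem mem_locallyNilpotentSubspace_of_apply {f : Module.End ℂ V} {w : V}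
    (h : f w ∈ locallyNilpotentSubspace f) : w ∈ locallyNilpotentSubspace f := by
  obtain ⟨N, hN⟩ := h
  exact ⟨N + 1, by rw [pow_succ, Module.End.mul_apply, hN]⟩

/-- If the commutator `[f, x]` preserves the space where `f` is locally nilpotent, so does `x`. -/
theorem locallyNilpotentSubspace_le_comap {f x : Module.End ℂ V}
    (h : locallyNilpotentSubspace f ≤ (locallyNilpotentSubspace f).comap (f * x - x * f)) :
    locallyNilpotentSubspace f ≤ (locallyNilpotentSubspace f).comap x := by
  have key : ∀ (N : ℕ) (w : V), (f ^ N) w = 0 → x w ∈ locallyNilpotentSubspace f := by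
    intro N
    induction N with
    | zero => intro w hw; simp_all
    | succ N ih =>
      intro w hw
      refine mem_locallyNilpotentSubspace_of_apply ?_
      have h1 := h (show w ∈ _ from ⟨N + 1, hw⟩)
      have h2 : f (x w) = (f * x - x * f) w + x (f w) := by simp
      rw [h2]
      exact add_mem h1 (ih _ (by rw [pow_succ] at hw; exact hw))
  rintro w ⟨N, hN⟩
  exact key N w hN

theorem locallyNilpotentSubspace_le_comap_of_commute {f x : Module.End ℂ V}
    (h : f * x = x * f) :
    locallyNilpotentSubspace f ≤ (locallyNilpotentSubspace f).comap x :=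
  locallyNilpotentSubspace_le_comap (by simp [h])

end SlTwo

/-! ### Relations in a contragredient Lie superalgebra and in its modules -/

namespace Realization

variable {n : ℕ} {A : Matrix (Fin n) (Fin n) ℂ} {H : Type*} [AddCommGroup H] [Module ℂ H]
  (R : Realization A H) (p : Fin n → ZMod 2)

/-- The image in `𝔤(A)` of a word in the generators. -/
noncomputable def wordClass (w : FreeMagma (ChevalleyGen n H)) : R.Space p :=
  Submodule.Quotient.mk (Submodule.Quotient.mk (word w))

theorem wordClass_mem_part (w : FreeMagma (ChevalleyGen n H)) :
    R.wordClass p w ∈ (R.contragredient p).part (wordParity (ChevalleyGen.parity p) w) :=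
  ⟨_, ⟨_, word_mem_wordPart (ChevalleyGen.parity p) w, rfl⟩, rfl⟩

theorem wordClass_mul (u v : FreeMagma (ChevalleyGen n H)) :
    R.wordClass p (u * v) = (R.contragredient p).bracket (R.wordClass p u) (R.wordClass p v) := by
  rw [wordClass, ← word_mul]
  rfl

theorem space_induction {P : R.Space p → Prop} (h0 : P 0) (hadd : ∀ x y, P x → P y → P (x + y))
    (hsmul : ∀ (c : ℂ) x, P x → P (c • x)) (hw : ∀ w, P (R.wordClass p w)) (x : R.Space p) :
    P x := by
  obtain ⟨x, rfl⟩ := Submodule.Quotient.mk_surjective _ x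
  obtain ⟨x, rfl⟩ := Submodule.Quotient.mk_surjective _ x
  induction x using MonoidAlgebra.induction_linear with
  | zero => exact h0
  | add x y hx hy => exact hadd _ _ hx hy
  | single w c =>
    have hc : (MonoidAlgebra.single w c : FreeNonUnitalNonAssocAlgebra ℂ (ChevalleyGen n H)) =
        c • word w := by
      simp [word, MonoidAlgebra.smul_single]
    rw [hc]
    exact hsmul c _ (hw w)

theorem mk_mk_eq_zero {x : FreeNonUnitalNonAssocAlgebra ℂ (ChevalleyGen n H)}
    (hx : R.IsChevalleyRelator x) :
    (Submodule.Quotient.mk (Submodule.Quotient.mk x : R.BarSpace p) : R.Space p) = 0 := by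
  have h : (Submodule.Quotient.mk x : R.BarSpace p) = 0 :=
    (Submodule.Quotient.mk_eq_zero _).2
      ((freeSuperAlgebra (ChevalleyGen.parity p)).subset_idealSpan _ (Or.inr hx))
  rw [h]
  rfl

theorem h_mem_part (a : H) : R.h p a ∈ (R.contragredient p).part 0 :=
  R.wordClass_mem_part p (.of (.h a))

theorem X_mem_part (i : Fin n) : R.X p i ∈ (R.contragredient p).part (p i) :=
  R.wordClass_mem_part p (.of (.X i))

theorem Y_mem_part (i : Fin n) : R.Y p i ∈ (R.contragredient p).part (p i) :=
  R.wordClass_mem_part p (.of (.Y i))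

theorem h_add (a b : H) : R.h p (a + b) = R.h p a + R.h p b :=
  sub_eq_zero.1 (R.mk_mk_eq_zero p (.add a b))

theorem bracket_h_X (a : H) (i : Fin n) :
    (R.contragredient p).bracket (R.h p a) (R.X p i) = R.root i a • R.X p i :=
  sub_eq_zero.1 (R.mk_mk_eq_zero p (.hX a i))

theorem bracket_h_Y (a : H) (i : Fin n) :
    (R.contragredient p).bracket (R.h p a) (R.Y p i) = -(R.root i a • R.Y p i) :=
  eq_neg_of_add_eq_zero_left (R.mk_mk_eq_zero p (.hY a i))

theorem bracket_X_Y (i j : Fin n) : (R.contragredient p).bracket (R.X p i) (R.Y p j) =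
    if i = j then R.h p (R.coroot i) else 0 := by
  split_ifs with hij
  · subst hij
    exact sub_eq_zero.1 (R.mk_mk_eq_zero p (.XY_same i))
  · exact R.mk_mk_eq_zero p (.XY_ne i j hij)

variable {V : Type*} [AddCommGroup V] [Module ℂ V] (M : (R.contragredient p).Rep V)

/-- The action of `Xᵢ`. -/
noncomputable def opX (i : Fin n) : Module.End ℂ V := M.act (R.X p i)

/-- The action of `Yᵢ`. -/
noncomputable def opY (i : Fin n) : Module.End ℂ V := M.act (R.Y p i)

/-- The action of `a ∈ 𝔥`. -/
noncomputable def opH (a : H) : Module.End ℂ V := M.act (R.h p a)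

theorem opH_add (a b : H) : R.opH p M (a + b) = R.opH p M a + R.opH p M b := by
  simp [opH, h_add]

variable {R p}

theorem act_bracket_h (a : H) (x : R.Space p) (w : V) :
    M.act ((R.contragredient p).bracket (R.h p a) x) w =
      R.opH p M a (M.act x w) - M.act x (R.opH p M a w) := by
  obtain ⟨x0, h0, x1, h1, rfl⟩ := (R.contragredient p).exists_add x
  rw [map_add, map_add, LinearMap.add_apply, M.act_bracket (R.h_mem_part p a) h0,
    M.act_bracket (R.h_mem_part p a) h1]
  simp [superSign, opH]
  abel

theorem opH_opX (a : H) (i : Fin n) (w : V) : R.opH p M a (R.opX p M i w) =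
    R.opX p M i (R.opH p M a w) + R.root i a • R.opX p M i w := by
  have h := act_bracket_h M a (R.X p i) w
  rw [bracket_h_X, map_smul, LinearMap.smul_apply] at h
  rw [opX, h]
  abel

theorem opH_opY (a : H) (i : Fin n) (w : V) : R.opH p M a (R.opY p M i w) =
    R.opY p M i (R.opH p M a w) - R.root i a • R.opY p M i w := by
  have h := act_bracket_h M a (R.Y p i) w
  rw [bracket_h_Y, map_neg, map_smul, LinearMap.neg_apply, LinearMap.smul_apply] at h
  rw [opY, sub_eq_add_neg, h]
  abel

theorem opX_opY (i j : Fin n) (w : V) : R.opX p M i (R.opY p M j w) =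
    superSign (p i) (p j) • R.opY p M j (R.opX p M i w) +
      if i = j then R.opH p M (R.coroot i) w else 0 := by
  have h := M.act_bracket (R.X_mem_part p i) (R.Y_mem_part p j) w
  rw [bracket_X_Y, eq_sub_iff_add_eq] at h
  rw [opX, opY, ← h, add_comm]
  split_ifs <;> simp [opH]

variable {M} in
/-- A subspace is stable if it is stable under the generators. -/
theorem isStable_of_generators {W : Submodule ℂ V} (hH : ∀ a, ∀ w ∈ W, R.opH p M a w ∈ W)
    (hX : ∀ i, ∀ w ∈ W, R.opX p M i w ∈ W) (hY : ∀ i, ∀ w ∈ W, R.opY p M i w ∈ W) :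
    M.IsStable W := by
  have key : ∀ u : FreeMagma (ChevalleyGen n H), ∀ w ∈ W, M.act (R.wordClass p u) w ∈ W := by
    intro u
    induction u using FreeMagma.rec with
    | of g =>
      cases g with
      | h a => exact hH a
      | X i => exact hX i
      | Y i => exact hY i
    | mul u v hu hv =>
      intro w hw
      rw [show u.mul v = u * v from rfl, wordClass_mul, M.act_bracket (R.wordClass_mem_part p u) (R.wordClass_mem_part p v)]
      exact sub_mem (hu _ (hv _ hw)) (Submodule.smul_mem _ _ (hv _ (hu _ hw)))
  intro x
  refine R.space_induction p (P := fun x => ∀ w ∈ W, M.act x w ∈ W) ?_ ?_ ?_ key x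
  · simp
  · intro x y hx hy w hw
    rw [map_add]
    exact add_mem (hx w hw) (hy w hw)
  · intro c x hx w hw
    rw [map_smul]
    exact Submodule.smul_mem _ _ (hx w hw)

/-! ### Subspaces generated by the lowering operators -/

variable (R p)

/-- The smallest subspace that contains `S` and is stable under the `Yᵢ`. -/
def lowerSpan (S : Set V) : Submodule ℂ V :=
  sInf {W | S ⊆ W ∧ ∀ i, ∀ w ∈ W, R.opY p M i w ∈ W}

variable {R p M}

theorem subset_lowerSpan (S : Set V) : S ⊆ R.lowerSpan p M S := by
  intro x hx
  simp only [lowerSpan, SetLike.mem_coe, Submodule.mem_sInf]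
  exact fun W hW => hW.1 hx

theorem opY_mem_lowerSpan {S : Set V} (i : Fin n) {w : V} (hw : w ∈ R.lowerSpan p M S) :
    R.opY p M i w ∈ R.lowerSpan p M S := by
  simp only [lowerSpan, Submodule.mem_sInf] at hw ⊢
  exact fun W hW => hW.2 i w (hw W hW)

theorem lowerSpan_le {S : Set V} {W : Submodule ℂ V} (hS : S ⊆ W)
    (hW : ∀ i, ∀ w ∈ W, R.opY p M i w ∈ W) : R.lowerSpan p M S ≤ W :=
  sInf_le ⟨hS, hW⟩

theorem isGradedSubspace_of_le {W : Submodule ℂ V}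
    (h : W ≤ (W ⊓ M.part 0) ⊔ (W ⊓ M.part 1)) : IsGradedSubspace M.part W := by
  intro a ha b hb hab
  obtain ⟨a', ha', b', hb', h⟩ := Submodule.mem_sup.1 (h hab)
  have h1 : a' - a = b - b' := by rw [sub_eq_sub_iff_add_eq_add, h, add_comm]
  have h0 : a' - a = 0 := by
    have hd := M.isCompl_part.disjoint
    rw [Submodule.disjoint_def] at hd
    exact hd _ (sub_mem ha'.2 ha) (h1 ▸ sub_mem hb hb'.2)
  rw [h0] at h1
  rw [← sub_eq_zero.1 h0, sub_eq_zero.1 h1.symm]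
  exact ⟨ha'.1, hb'.1⟩

theorem mem_part_cases {i : ZMod 2} {W : Submodule ℂ V} {w : V} (hw : w ∈ W)
    (hi : w ∈ M.part i) : w ∈ (W ⊓ M.part 0) ⊔ (W ⊓ M.part 1) := by
  have h2 : ∀ i : ZMod 2, i = 0 ∨ i = 1 := by decide
  rcases h2 i with rfl | rfl
  · exact Submodule.mem_sup_left ⟨hw, hi⟩
  · exact Submodule.mem_sup_right ⟨hw, hi⟩

theorem isGradedSubspace_lowerSpan {S : Set V} (hS : ∀ s ∈ S, ∃ i, s ∈ M.part i) :
    IsGradedSubspace M.part (R.lowerSpan p M S) := by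
  refine isGradedSubspace_of_le (lowerSpan_le ?_ ?_)
  · intro s hs
    obtain ⟨i, hi⟩ := hS s hs
    exact mem_part_cases (subset_lowerSpan S hs) hi
  · intro i w hw
    obtain ⟨a, ha, b, hb, rfl⟩ := Submodule.mem_sup.1 hw
    rw [map_add]
    exact add_mem (mem_part_cases (opY_mem_lowerSpan i ha.1) (M.act_mem (R.Y_mem_part p i) ha.2))
      (mem_part_cases (opY_mem_lowerSpan i hb.1) (M.act_mem (R.Y_mem_part p i) hb.2))

/-- This replaces the triangular decomposition of the enveloping algebra: moving 𝔥 and Xᵢ past a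
lowering operator only creates terms already in the span, so stability need only be tested on S. -/
theorem isStable_lowerSpan {S : Set V} (hH : ∀ a, ∀ s ∈ S, R.opH p M a s ∈ R.lowerSpan p M S)
    (hX : ∀ i, ∀ s ∈ S, R.opX p M i s ∈ R.lowerSpan p M S) :
    M.IsStable (R.lowerSpan p M S) := by
  have hH' : ∀ a, ∀ w ∈ R.lowerSpan p M S, R.opH p M a w ∈ R.lowerSpan p M S := by
    intro a
    have : R.lowerSpan p M S ≤ R.lowerSpan p M S ⊓ (R.lowerSpan p M S).comap (R.opH p M a) := by
      refine lowerSpan_le (fun s hs => ⟨subset_lowerSpan S hs, hH a s hs⟩) fun i w hw => ?_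
      refine ⟨opY_mem_lowerSpan i hw.1, ?_⟩
      rw [SetLike.mem_coe, Submodule.mem_comap, opH_opY]
      exact sub_mem (opY_mem_lowerSpan i hw.2) (Submodule.smul_mem _ _ (opY_mem_lowerSpan i hw.1))
    exact fun w hw => (this hw).2
  refine isStable_of_generators hH' (fun i => ?_) (fun i w hw => opY_mem_lowerSpan i hw)
  have : R.lowerSpan p M S ≤ R.lowerSpan p M S ⊓ (R.lowerSpan p M S).comap (R.opX p M i) := by
    refine lowerSpan_le (fun s hs => ⟨subset_lowerSpan S hs, hX i s hs⟩) fun j w hw => ?_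
    refine ⟨opY_mem_lowerSpan j hw.1, ?_⟩
    rw [SetLike.mem_coe, Submodule.mem_comap, opX_opY]
    refine add_mem (Submodule.smul_mem _ _ (opY_mem_lowerSpan j hw.2)) ?_
    split_ifs
    · exact hH' _ _ hw.1
    · exact zero_mem _
  exact fun w hw => (this hw).2

end Realization

/-! ### Irreducible highest weight modules -/

namespace Realization

variable {n : ℕ} {A : Matrix (Fin n) (Fin n) ℂ} {H : Type*} [AddCommGroup H] [Module ℂ H]
  {R : Realization A H} {p : Fin n → ZMod 2}
  {V : Type*} [AddCommGroup V] [Module ℂ V] {M : (R.contragredient p).Rep V}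

variable (R) in
/-- There is an element of `𝔥` on which all simple roots take the value `1`. -/
theorem exists_root_eq_one : ∃ d : H, ∀ i, R.root i d = 1 := by
  have := R.finiteDimensional
  obtain ⟨φ, hφ⟩ : ∃ φ : Module.Dual ℂ (Module.Dual ℂ H), ∀ i, φ (R.root i) = 1 := by
    let b := Module.Basis.extend R.linearIndependent_root.linearIndepOn_id
    refine ⟨b.constr ℂ fun _ => 1, fun i => ?_⟩
    have hi : R.root i ∈ R.linearIndependent_root.linearIndepOn_id.extend (Set.subset_univ _) :=
      Module.Basis.subset_extend _ ⟨i, rfl⟩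
    have hb : b ⟨R.root i, hi⟩ = R.root i := Module.Basis.extend_apply_self _ _
    rw [← hb, Module.Basis.constr_basis]
  obtain ⟨d, rfl⟩ := (Module.evalEquiv ℂ H).surjective φ
  exact ⟨d, hφ⟩

variable (R p M) in
/-- `v` is a homogeneous highest weight vector of the irreducible module `M`. -/
structure IsHighestVector (lam : Module.Dual ℂ H) (v : V) : Prop where
  irr : M.IsIrreducible
  ne_zero : v ≠ 0
  homogeneous : ∃ i, v ∈ M.part i
  opX_eq : ∀ i, R.opX p M i v = 0
  opH_eq : ∀ a, R.opH p M a v = lam a • v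

theorem part_unique {i j : ZMod 2} (hij : i + 1 = j) {a b a' b' : V} (ha : a ∈ M.part i)
    (hb : b ∈ M.part j) (ha' : a' ∈ M.part i) (hb' : b' ∈ M.part j) (h : a + b = a' + b') :
    a = a' ∧ b = b' := by
  have hd : Disjoint (M.part i) (M.part j) := by
    subst hij
    have h2 : ∀ i : ZMod 2, i = 0 ∨ i = 1 := by decide
    rcases h2 i with rfl | rfl
    · exact M.isCompl_part.disjoint
    · exact M.isCompl_part.disjoint.symm
  have h1 : a - a' = b' - b := by rw [sub_eq_sub_iff_add_eq_add, h, add_comm]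
  have h0 : a - a' = 0 := (Submodule.disjoint_def.1 hd) _ (sub_mem ha ha') (h1 ▸ sub_mem hb' hb)
  rw [h0] at h1
  exact ⟨sub_eq_zero.1 h0, (sub_eq_zero.1 h1.symm).symm⟩

theorem exists_add (w : V) : ∃ a ∈ M.part 0, ∃ b ∈ M.part 1, a + b = w := by
  have h : w ∈ M.part 0 ⊔ M.part 1 := by rw [M.isCompl_part.sup_eq_top]; trivial
  exact Submodule.mem_sup.1 h

theorem opX_components {i : Fin n} {a b : V} (ha : a ∈ M.part 0) (hb : b ∈ M.part 1)
    (h : R.opX p M i (a + b) = 0) : R.opX p M i a = 0 ∧ R.opX p M i b = 0 := by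
  refine part_unique (M := M) (i := p i + 0) (j := p i + 1) (by ring)
    (M.act_mem (R.X_mem_part p i) ha) (M.act_mem (R.X_mem_part p i) hb) (zero_mem _) (zero_mem _) ?_
  rw [← map_add, h, add_zero]

theorem opH_components {x : H} {c : ℂ} {a b : V} (ha : a ∈ M.part 0) (hb : b ∈ M.part 1)
    (h : R.opH p M x (a + b) = c • (a + b)) :
    R.opH p M x a = c • a ∧ R.opH p M x b = c • b := by
  refine part_unique (M := M) (i := 0 + 0) (j := 0 + 1) (by ring)
    (M.act_mem (R.h_mem_part p x) ha) (M.act_mem (R.h_mem_part p x) hb)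
    (Submodule.smul_mem _ _ ha) (Submodule.smul_mem _ _ hb) ?_
  rw [← map_add, h, smul_add]

/-- The generators are homogeneous, so each homogeneous component of a highest weight vector
satisfies the same equations, and one of them is nonzero. Homogeneity is needed because
irreducibility only concerns graded submodules. -/
theorem IsHighestWeight.exists_isHighestVector {lam : Module.Dual ℂ H} (hirr : M.IsIrreducible)
    (h : R.IsHighestWeight p M lam) : ∃ v, R.IsHighestVector p M lam v := by
  obtain ⟨v, hv, hn, hh, -⟩ := h
  have hX : ∀ i, R.opX p M i v = 0 := by
    intro i
    refine hn _ ?_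
    simp only [nPlus, LieSuperalgebra.subalgebraSpan, Submodule.mem_sInf]
    exact fun W hW => hW.1 ⟨i, rfl⟩
  obtain ⟨a, ha, b, hb, rfl⟩ := exists_add (M := M) v
  by_cases h0 : a = 0
  · refine ⟨b, hirr, ?_, ⟨1, hb⟩, fun i => (opX_components ha hb (hX i)).2,
      fun x => (opH_components ha hb (hh x)).2⟩
    rintro rfl
    simp [h0] at hv
  · exact ⟨a, hirr, h0, ⟨0, ha⟩, fun i => (opX_components ha hb (hX i)).1,
      fun x => (opH_components ha hb (hh x)).1⟩

variable (R p M) in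
/-- The sum of the eigenspaces of `d` for the eigenvalues `c - k, c - k - 1, …`. -/
noncomputable def depthSpace (d : H) (c : ℂ) (k : ℕ) : Submodule ℂ V :=
  ⨆ m : ℕ, (R.opH p M d).eigenspace (c - (k + m : ℕ))

theorem map_depthSpace {d : H} {c : ℂ} {f : Module.End ℂ V} {j : ℕ}
    (hf : ∀ w, R.opH p M d (f w) = f (R.opH p M d w) - (j : ℂ) • f w) (k : ℕ) :
    R.depthSpace p M d c k ≤ (R.depthSpace p M d c (k + j)).comap f := by
  refine iSup_le fun m w hw => ?_
  rw [Module.End.mem_eigenspace_iff] at hw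
  refine Submodule.mem_iSup_of_mem m ?_
  rw [Module.End.mem_eigenspace_iff, hf, hw, map_smul]
  push_cast
  module

theorem depthSpace_antitone {d : H} {c : ℂ} {k l : ℕ} (h : k ≤ l) :
    R.depthSpace p M d c l ≤ R.depthSpace p M d c k := by
  refine iSup_le fun m => ?_
  have h1 : l + m = k + (l - k + m) := by omega
  rw [h1]
  exact le_iSup (fun m : ℕ => (R.opH p M d).eigenspace (c - (k + m : ℕ))) (l - k + m)

/-- Eigenspaces for distinct eigenvalues are independent. -/
theorem eq_zero_of_mem_depthSpace {d : H} {c c' : ℂ} {k : ℕ} (hc : ∀ m : ℕ, c' ≠ c - (k + m : ℕ))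
    {w : V} (hw : w ∈ R.depthSpace p M d c k) (h : R.opH p M d w = c' • w) : w = 0 := by
  have hi := (R.opH p M d).eigenspaces_iSupIndep c'
  refine Submodule.disjoint_def.1 hi w (Module.End.mem_eigenspace_iff.2 h) ?_
  have hle : R.depthSpace p M d c k ≤ ⨆ j, ⨆ (_ : j ≠ c'), (R.opH p M d).eigenspace j :=
    iSup_le fun m => le_iSup₂_of_le (c - (k + m : ℕ)) (hc m).symm le_rfl
  exact hle hw

variable (R p M) in
/-- A homogeneous operator of parity `ε` and weight `β`. -/
structure IsWeightOp (ε : ZMod 2) (β : Module.Dual ℂ H) (z : Module.End ℂ V) : Prop where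
  mem : ∀ {i : ZMod 2} {w : V}, w ∈ M.part i → z w ∈ M.part (ε + i)
  opH : ∀ a w, R.opH p M a (z w) = z (R.opH p M a w) + β a • z w

namespace IsWeightOp

variable {ε ε' : ZMod 2} {β β' : Module.Dual ℂ H} {z z' : Module.End ℂ V}

theorem opX (i : Fin n) : R.IsWeightOp p M (p i) (R.root i) (R.opX p M i) :=
  ⟨fun hw => M.act_mem (R.X_mem_part p i) hw, fun a w => opH_opX M a i w⟩

theorem opY (i : Fin n) : R.IsWeightOp p M (p i) (-R.root i) (R.opY p M i) :=
  ⟨fun hw => M.act_mem (R.Y_mem_part p i) hw, fun a w => by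
    rw [opH_opY, LinearMap.neg_apply, neg_smul, sub_eq_add_neg]⟩

theorem mul (h : R.IsWeightOp p M ε β z) (h' : R.IsWeightOp p M ε' β' z') :
    R.IsWeightOp p M (ε + ε') (β + β') (z * z') :=
  ⟨fun hw => by rw [add_assoc]; exact h.mem (h'.mem hw), fun a w => by
    simp only [Module.End.mul_apply, h.opH, h'.opH, map_add, map_smul, LinearMap.add_apply]
    module⟩

theorem add (h : R.IsWeightOp p M ε β z) (h' : R.IsWeightOp p M ε β z') :
    R.IsWeightOp p M ε β (z + z') :=
  ⟨fun hw => add_mem (h.mem hw) (h'.mem hw), fun a w => by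
    simp only [LinearMap.add_apply, h.opH, h'.opH, map_add]
    module⟩

theorem smul (c : ℂ) (h : R.IsWeightOp p M ε β z) : R.IsWeightOp p M ε β (c • z) :=
  ⟨fun hw => Submodule.smul_mem _ _ (h.mem hw), fun a w => by
    simp only [LinearMap.smul_apply, h.opH, map_smul]
    module⟩

theorem bracket (c : ℂ) (h : R.IsWeightOp p M ε β z) (h' : R.IsWeightOp p M ε' β' z') :
    R.IsWeightOp p M (ε + ε') (β + β') (z * z' + c • (z' * z)) :=
  (h.mul h').add (by rw [add_comm ε, add_comm β]; exact (h'.mul h).smul c)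

theorem opH_apply_of_eq (h : R.IsWeightOp p M ε β z) {a : H} {c : ℂ} {w : V}
    (hw : R.opH p M a w = c • w) : R.opH p M a (z w) = (c + β a) • z w := by
  rw [h.opH, hw, map_smul]
  module

theorem opH_pow_apply_of_eq (h : R.IsWeightOp p M ε β z) {a : H} {c : ℂ} {w : V}
    (hw : R.opH p M a w = c • w) (k : ℕ) :
    R.opH p M a ((z ^ k) w) = (c + k * β a) • (z ^ k) w := by
  induction k with
  | zero => simpa using hw
  | succ k ih =>
    rw [pow_succ', Module.End.mul_apply, h.opH_apply_of_eq ih]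
    push_cast
    module

end IsWeightOp

namespace IsHighestVector

variable {lam : Module.Dual ℂ H} {v : V}

theorem lowerSpan_eq_top (hv : R.IsHighestVector p M lam v) : R.lowerSpan p M {v} = ⊤ := by
  refine (hv.irr.2 _ (isStable_lowerSpan ?_ ?_) (isGradedSubspace_lowerSpan ?_)).resolve_left ?_
  · rintro a s rfl
    rw [hv.opH_eq]
    exact Submodule.smul_mem _ _ (subset_lowerSpan _ rfl)
  · rintro i s rfl
    rw [hv.opX_eq]
    exact zero_mem _
  · rintro s rfl
    exact hv.homogeneous
  · intro h0
    have := subset_lowerSpan (R := R) (p := p) (M := M) {v} rfl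
    rw [h0] at this
    exact hv.ne_zero this

end IsHighestVector
end Realization

/-! ### Vanishing of singular vectors and of operators in irreducible modules -/

namespace Realization

variable {n : ℕ} {A : Matrix (Fin n) (Fin n) ℂ} {H : Type*} [AddCommGroup H] [Module ℂ H]
  {R : Realization A H} {p : Fin n → ZMod 2}
  {V : Type*} [AddCommGroup V] [Module ℂ V] {M : (R.contragredient p).Rep V}

namespace IsHighestVector

variable {lam : Module.Dual ℂ H} {v : V} {d : H}

theorem depthSpace_zero_eq_top (hv : R.IsHighestVector p M lam v) (hd : ∀ i, R.root i d = 1) :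
    R.depthSpace p M d (lam d) 0 = ⊤ := by
  rw [eq_top_iff, ← hv.lowerSpan_eq_top]
  refine lowerSpan_le ?_ fun i w hw => ?_
  · rintro s rfl
    refine Submodule.mem_iSup_of_mem 0 ?_
    rw [Module.End.mem_eigenspace_iff, hv.opH_eq]
    simp
  · exact depthSpace_antitone (Nat.zero_le _)
      (map_depthSpace (j := 1) (fun w => by rw [opH_opY, hd]; simp) 0 hw)

/-- A graded submodule of positive depth misses v, which has depth 0, so it is proper. All vanishing
results for objects of lower weight rest on this. -/
theorem eq_bot_of_le_depthSpace (hv : R.IsHighestVector p M lam v) {W : Submodule ℂ V}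
    (hW : M.IsStable W) (hg : IsGradedSubspace M.part W)
    {k : ℕ} (hk : 0 < k) (hle : W ≤ R.depthSpace p M d (lam d) k) : W = ⊥ := by
  refine (hv.irr.2 W hW hg).resolve_right fun h => hv.ne_zero ?_
  refine eq_zero_of_mem_depthSpace (c' := lam d) (fun m hm => ?_) (hle (h ▸ Submodule.mem_top))
    (hv.opH_eq d)
  have h1 : ((k + m : ℕ) : ℂ) = 0 := by linear_combination hm
  rw [Nat.cast_eq_zero] at h1
  omega

theorem lowerSpan_le_depthSpace (hd : ∀ i, R.root i d = 1) {S : Set V} {c : ℂ} {k : ℕ}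
    (hS : S ⊆ R.depthSpace p M d c k) : R.lowerSpan p M S ≤ R.depthSpace p M d c k :=
  lowerSpan_le hS fun i _ hw => depthSpace_antitone (Nat.le_succ _)
    (map_depthSpace (j := 1) (fun w => by rw [opH_opY, hd]; simp) k hw)

/-- An operator of negative weight that commutes with the raising operators up to scalars
vanishes. -/
theorem eq_zero_of_weight_neg (hv : R.IsHighestVector p M lam v) (hd : ∀ i, R.root i d = 1)
    {ε : ZMod 2} {β : Module.Dual ℂ H} {z : Module.End ℂ V} (hz : R.IsWeightOp p M ε β z)
    {k : ℕ} (hk : 0 < k) (hβ : β d = -(k : ℂ))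
    (hX : ∀ i, ∃ s : ℂ, ∀ w, R.opX p M i (z w) = s • z (R.opX p M i w)) : z = 0 := by
  -- Only images of homogeneous vectors are taken, so that the span is a graded subspace.
  let S : Set V := {u | ∃ i, ∃ w ∈ M.part i, u = z w}
  have hbot : R.lowerSpan p M S = ⊥ := by
    refine hv.eq_bot_of_le_depthSpace (d := d) (isStable_lowerSpan ?_ ?_)
      (isGradedSubspace_lowerSpan ?_) hk (lowerSpan_le_depthSpace hd ?_)
    · rintro a s ⟨i, w, hw, rfl⟩
      rw [hz.opH]
      exact add_mem (subset_lowerSpan _ ⟨0 + i, _, M.act_mem (R.h_mem_part p a) hw, rfl⟩)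
        (Submodule.smul_mem _ _ (subset_lowerSpan _ ⟨i, w, hw, rfl⟩))
    · rintro j s ⟨i, w, hw, rfl⟩
      obtain ⟨c, hc⟩ := hX j
      rw [hc]
      exact Submodule.smul_mem _ _
        (subset_lowerSpan _ ⟨p j + i, _, M.act_mem (R.X_mem_part p j) hw, rfl⟩)
    · rintro s ⟨i, w, hw, rfl⟩
      exact ⟨_, hz.mem hw⟩
    · rintro s ⟨i, w, hw, rfl⟩
      have h0 : w ∈ R.depthSpace p M d (lam d) 0 := by
        rw [hv.depthSpace_zero_eq_top hd]; trivial
      have := map_depthSpace (f := z) (j := k)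
        (fun w => by rw [hz.opH, hβ, neg_smul, sub_eq_add_neg]) 0 h0
      rwa [zero_add] at this
  have h0 : ∀ i, ∀ w ∈ M.part i, z w = 0 := by
    intro i w hw
    have : z w ∈ R.lowerSpan p M S := subset_lowerSpan _ ⟨i, w, hw, rfl⟩
    rwa [hbot, Submodule.mem_bot] at this
  ext w
  obtain ⟨a, ha, b, hb, rfl⟩ := exists_add (M := M) w
  rw [map_add, h0 _ a ha, h0 _ b hb]
  simp

/-- Singular vectors of lower weight vanish. -/
theorem eq_zero_of_singular (hv : R.IsHighestVector p M lam v) (hd : ∀ i, R.root i d = 1)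
    {w : V} {ν : Module.Dual ℂ H} (hw : ∀ a, R.opH p M a w = ν a • w)
    (hX : ∀ i, R.opX p M i w = 0) {k : ℕ} (hk : 0 < k) (hν : ν d = lam d - k) : w = 0 := by
  have key : ∀ i, ∀ u ∈ M.part i, (∀ a, R.opH p M a u = ν a • u) → (∀ i, R.opX p M i u = 0) →
      u = 0 := by
    intro i u hu hH hX
    have hbot : R.lowerSpan p M {u} = ⊥ := by
      refine hv.eq_bot_of_le_depthSpace (d := d) (isStable_lowerSpan ?_ ?_)
        (isGradedSubspace_lowerSpan ?_) hk (lowerSpan_le_depthSpace hd ?_)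
      · rintro a s rfl
        rw [hH]
        exact Submodule.smul_mem _ _ (subset_lowerSpan _ rfl)
      · rintro j s rfl
        rw [hX]
        exact zero_mem _
      · rintro s rfl
        exact ⟨i, hu⟩
      · rintro s rfl
        refine Submodule.mem_iSup_of_mem 0 ?_
        rw [Module.End.mem_eigenspace_iff, hH, hν, add_zero]
    have : u ∈ R.lowerSpan p M {u} := subset_lowerSpan _ rfl
    rwa [hbot, Submodule.mem_bot] at this
  obtain ⟨a, ha, b, hb, rfl⟩ := exists_add (M := M) w
  rw [key 0 a ha (fun x => (opH_components ha hb (hw x)).1)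
    (fun i => (opX_components ha hb (hX i)).1), key 1 b hb
    (fun x => (opH_components ha hb (hw x)).2) (fun i => (opX_components ha hb (hX i)).2), add_zero]

/-- An operator that commutes with the lowering operators up to scalars and kills the highest
weight vector vanishes. -/
theorem eq_zero_of_apply_eq_zero (hv : R.IsHighestVector p M lam v) {z : Module.End ℂ V}
    (hz : z v = 0) (hY : ∀ i, ∃ s : ℂ, ∀ w, z (R.opY p M i w) = s • R.opY p M i (z w)) :
    z = 0 := by
  have h : LinearMap.ker z = ⊤ := by
    rw [eq_top_iff, ← hv.lowerSpan_eq_top]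
    refine lowerSpan_le (by rintro s rfl; exact hz) fun i w hw => ?_
    obtain ⟨s, hs⟩ := hY i
    rw [LinearMap.mem_ker] at hw ⊢
    rw [hs, hw, map_zero, smul_zero]
  exact LinearMap.ker_eq_top.1 h

end IsHighestVector

/-! ### Weights -/

variable (R p M) in
/-- `ν` is a weight of `M`. -/
def IsWeight (ν : Module.Dual ℂ H) : Prop :=
  ∃ w : V, w ≠ 0 ∧ ∀ a, R.opH p M a w = ν a • w

variable (R p M) in
/-- Every `β`-string of weights is bounded above. -/
def HasBoundedStrings (β : Module.Dual ℂ H) : Prop :=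
  ∀ ν, R.IsWeight p M ν → ∃ N : ℕ, ∀ k ≥ N, ¬ R.IsWeight p M (ν + (k : ℂ) • β)

theorem HasBoundedStrings.two_smul {β : Module.Dual ℂ H} (h : R.HasBoundedStrings p M β) :
    R.HasBoundedStrings p M ((2 : ℂ) • β) := by
  intro ν hν
  obtain ⟨N, hN⟩ := h ν hν
  refine ⟨N, fun k hk => ?_⟩
  have := hN (2 * k) (by omega)
  rwa [Nat.cast_mul, mul_comm, mul_smul] at this

/-- The weights are permuted by a reflection that comes from a locally nilpotent `sl₂`-triple. -/
theorem IsWeight.reflection {e f : Module.End ℂ V} {a : H} {ε ε' : ZMod 2} {γ : Module.Dual ℂ H}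
    (T : IsSlTwoOps e f (R.opH p M a)) (he : R.IsWeightOp p M ε γ e)
    (hf : R.IsWeightOp p M ε' (-γ) f) (hen : ∀ w, ∃ N, (e ^ N) w = 0)
    (hfn : ∀ w, ∃ N, (f ^ N) w = 0) {ν : Module.Dual ℂ H} (hν : R.IsWeight p M ν) :
    R.IsWeight p M (ν - ν a • γ) := by
  obtain ⟨w, hw0, hw⟩ := hν
  obtain ⟨j, k, hjk, h | h⟩ := T.exists_reflection hw0 (hw a) hen hfn
  · refine ⟨_, h, fun b => ?_⟩
    rw [hf.opH_pow_apply_of_eq (he.opH_pow_apply_of_eq (hw b) j), hjk]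
    simp
    module
  · refine ⟨_, h, fun b => ?_⟩
    rw [he.opH_pow_apply_of_eq (hf.opH_pow_apply_of_eq (hw b) k), hjk]
    simp
    module

/-- The reflection carries the β-string through a weight to the string of the reflected β through
the reflected weight. -/
theorem HasBoundedStrings.of_reflection {a : H} {γ : Module.Dual ℂ H}
    (h : ∀ ν, R.IsWeight p M ν → R.IsWeight p M (ν - ν a • γ)) {β : Module.Dual ℂ H}
    (hβ : R.HasBoundedStrings p M (β - β a • γ)) : R.HasBoundedStrings p M β := by
  intro ν hν
  obtain ⟨N, hN⟩ := hβ _ (h ν hν)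
  refine ⟨N, fun k hk hw => hN k hk ?_⟩
  convert h _ hw using 1
  simp only [LinearMap.add_apply, LinearMap.smul_apply, smul_eq_mul]
  module

theorem rootSpace_apply {μ : Module.Dual ℂ H} {x : R.Space p} (hx : x ∈ R.rootSpace p μ) (a : H)
    (w : V) : R.opH p M a (M.act x w) = M.act x (R.opH p M a w) + μ a • M.act x w := by
  simp only [rootSpace, Submodule.mem_iInf, LinearMap.mem_ker, LinearMap.sub_apply,
    LinearMap.smul_apply, LinearMap.id_apply, sub_eq_zero] at hx
  have h := act_bracket_h M a x w
  rw [hx, map_smul, LinearMap.smul_apply] at h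
  rw [h]
  abel

namespace IsHighestVector

variable {lam : Module.Dual ℂ H} {v : V} {d : H}

theorem exists_eq_of_isWeight (hv : R.IsHighestVector p M lam v) (hd : ∀ i, R.root i d = 1)
    {ν : Module.Dual ℂ H} (hν : R.IsWeight p M ν) : ∃ m : ℕ, ν d = lam d - m := by
  obtain ⟨w, hw0, hw⟩ := hν
  by_contra! h
  refine hw0 (eq_zero_of_mem_depthSpace (d := d) (c := lam d) (k := 0) (fun m => ?_) ?_ (hw d))
  · rw [zero_add]; exact h m
  · rw [hv.depthSpace_zero_eq_top hd]; trivial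

/-- A weight of depth m admits at most m steps of positive integral height before it would rise
above the highest weight. -/
theorem hasBoundedStrings_of_pos (hv : R.IsHighestVector p M lam v) (hd : ∀ i, R.root i d = 1)
    {β : Module.Dual ℂ H} {j : ℤ} (hj : 0 < j) (hβ : β d = j) : R.HasBoundedStrings p M β := by
  intro ν hν
  obtain ⟨m, hm⟩ := hv.exists_eq_of_isWeight hd hν
  refine ⟨m + 1, fun k hk hw => ?_⟩
  obtain ⟨l, hl⟩ := hv.exists_eq_of_isWeight hd hw
  rw [LinearMap.add_apply, LinearMap.smul_apply, hm, hβ, smul_eq_mul] at hl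
  have h1 : ((k * j : ℤ) : ℂ) = ((m - l : ℤ) : ℂ) := by
    push_cast
    linear_combination hl
  have h2 : (k : ℤ) * j = m - l := by exact_mod_cast h1
  have h3 : (k : ℤ) ≤ k * j := le_mul_of_one_le_right (by positivity) (by omega)
  omega

theorem span_weight_eq_top (hv : R.IsHighestVector p M lam v) :
    Submodule.span ℂ {w : V | ∃ ν : Module.Dual ℂ H, ∀ a, R.opH p M a w = ν a • w} = ⊤ := by
  rw [eq_top_iff, ← hv.lowerSpan_eq_top]
  refine lowerSpan_le ?_ fun i w hw => ?_
  · rintro s rfl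
    exact Submodule.subset_span ⟨lam, hv.opH_eq⟩
  · induction hw using Submodule.span_induction with
    | mem w hw =>
      obtain ⟨ν, hν⟩ := hw
      exact Submodule.subset_span ⟨ν + -R.root i, fun a =>
        (IsWeightOp.opY i).opH_apply_of_eq (hν a)⟩
    | zero => simp
    | add a b _ _ ha hb => rw [map_add]; exact add_mem ha hb
    | smul c a _ ha => rw [map_smul]; exact Submodule.smul_mem _ _ ha

/-- V is spanned by weight vectors, and a nonzero z^N w would have weight ν + Nβ. No homogeneity of
z is required, so this applies to arbitrary elements of a root space. -/
theorem locallyNilpotent_of_hasBoundedStrings (hv : R.IsHighestVector p M lam v)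
    {β : Module.Dual ℂ H} (hβ : R.HasBoundedStrings p M β) {z : Module.End ℂ V}
    (hz : ∀ a w, R.opH p M a (z w) = z (R.opH p M a w) + β a • z w) (w : V) :
    ∃ N, (z ^ N) w = 0 := by
  have h : locallyNilpotentSubspace z = ⊤ := by
    rw [eq_top_iff, ← hv.span_weight_eq_top, Submodule.span_le]
    rintro w ⟨ν, hν⟩
    by_cases hw0 : w = 0
    · rw [hw0]; exact zero_mem _
    obtain ⟨N, hN⟩ := hβ ν ⟨w, hw0, hν⟩
    refine ⟨N, by_contra fun hne => hN N le_rfl ⟨_, hne, fun a => ?_⟩⟩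
    have : ∀ k : ℕ, R.opH p M a ((z ^ k) w) = (ν a + k * β a) • (z ^ k) w := by
      intro k
      induction k with
      | zero => simpa using hν a
      | succ k ih =>
        rw [pow_succ', Module.End.mul_apply, hz, ih, map_smul]
        push_cast
        module
    rw [this]
    simp
  exact mem_locallyNilpotentSubspace.1 (h ▸ Submodule.mem_top)

theorem isLocallyNilpotent_of_hasBoundedStrings (hv : R.IsHighestVector p M lam v)
    {β : Module.Dual ℂ H} (hβ : R.HasBoundedStrings p M β) {x : R.Space p}
    (hx : x ∈ R.rootSpace p β) : M.IsLocallyNilpotent x := by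
  intro w
  obtain ⟨N, hN⟩ := hv.locallyNilpotent_of_hasBoundedStrings hβ (rootSpace_apply hx) w
  exact ⟨N + 1, N.succ_pos, by rw [pow_succ', Module.End.mul_apply, hN, map_zero]⟩

theorem locallyNilpotent_of_pos (hv : R.IsHighestVector p M lam v) (hd : ∀ i, R.root i d = 1)
    {ε : ZMod 2} {β : Module.Dual ℂ H} {z : Module.End ℂ V} (hz : R.IsWeightOp p M ε β z)
    {j : ℤ} (hj : 0 < j) (hβ : β d = j) (w : V) : ∃ N, (z ^ N) w = 0 :=
  hv.locallyNilpotent_of_hasBoundedStrings (hv.hasBoundedStrings_of_pos hd hj hβ) hz.opH w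

end IsHighestVector

end Realization

/-! ### Operator identities for `S(1,2,α)` -/

section OperatorRelations

variable {V : Type*} [AddCommGroup V] [Module ℂ V]

/-- The defining relations of `S(1,2,α)` for operators. -/
structure IsSOps (α : ℂ) (x y h : Fin 3 → Module.End ℂ V) : Prop where
  xy : ∀ i j w, x i (y j w) = superSign (parityS i) (parityS j) • y j (x i w) +
    if i = j then h i w else 0
  hx : ∀ i j w, h i (x j w) = x j (h i w) + cartanS α i j • x j w
  hy : ∀ i j w, h i (y j w) = y j (h i w) - cartanS α i j • y j w

namespace IsSOps

variable {α : ℂ} {x y h : Fin 3 → Module.End ℂ V}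

/-- Exchanging the two odd simple roots replaces α by -α, so each identity below that involves one
odd root need be computed only for the second one. -/
theorem swap (T : IsSOps α x y h) :
    IsSOps (-α) (x ∘ Equiv.swap 1 2) (y ∘ Equiv.swap 1 2) (h ∘ Equiv.swap 1 2) where
  xy i j w := by
    simp only [Function.comp_apply, T.xy, EmbeddingLike.apply_eq_iff_eq]
    fin_cases i <;> fin_cases j <;> rfl
  hx i j w := by
    simp only [Function.comp_apply, T.hx]
    congr 2
    fin_cases i <;> fin_cases j <;>
      simp [cartanS, Equiv.swap_apply_def, sub_eq_add_neg]
  hy i j w := by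
    simp only [Function.comp_apply, T.hy]
    congr 2
    fin_cases i <;> fin_cases j <;>
      simp [cartanS, Equiv.swap_apply_def, sub_eq_add_neg]

theorem x_y (T : IsSOps α x y h) :
    ((∀ w, x 0 (y 0 w) = y 0 (x 0 w) + h 0 w) ∧ (∀ w, x 0 (y 1 w) = y 1 (x 0 w)) ∧
      (∀ w, x 0 (y 2 w) = y 2 (x 0 w))) ∧
    ((∀ w, x 1 (y 0 w) = y 0 (x 1 w)) ∧ (∀ w, x 1 (y 1 w) = -y 1 (x 1 w) + h 1 w) ∧
      (∀ w, x 1 (y 2 w) = -y 2 (x 1 w))) ∧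
    ((∀ w, x 2 (y 0 w) = y 0 (x 2 w)) ∧ (∀ w, x 2 (y 1 w) = -y 1 (x 2 w)) ∧
      (∀ w, x 2 (y 2 w) = -y 2 (x 2 w) + h 2 w)) := by
  refine ⟨⟨?_, ?_, ?_⟩, ⟨?_, ?_, ?_⟩, ⟨?_, ?_, ?_⟩⟩ <;> intro w <;> rw [T.xy] <;>
    simp [superSign, parityS]

theorem h_y (T : IsSOps α x y h) :
    ((∀ w, h 0 (y 0 w) = y 0 (h 0 w) - (2 : ℂ) • y 0 w) ∧
      (∀ w, h 0 (y 1 w) = y 1 (h 0 w) + y 1 w) ∧ (∀ w, h 0 (y 2 w) = y 2 (h 0 w) + y 2 w)) ∧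
    ((∀ w, h 1 (y 0 w) = y 0 (h 1 w) - (-1 + α) • y 0 w) ∧ (∀ w, h 1 (y 1 w) = y 1 (h 1 w)) ∧
      (∀ w, h 1 (y 2 w) = y 2 (h 1 w) - y 2 w)) ∧
    ((∀ w, h 2 (y 0 w) = y 0 (h 2 w) - (-1 - α) • y 0 w) ∧
      (∀ w, h 2 (y 1 w) = y 1 (h 2 w) - y 1 w) ∧ (∀ w, h 2 (y 2 w) = y 2 (h 2 w))) := by
  refine ⟨⟨?_, ?_, ?_⟩, ⟨?_, ?_, ?_⟩, ⟨?_, ?_, ?_⟩⟩ <;> intro w <;> rw [T.hy] <;>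
    simp [cartanS]

theorem h_x (T : IsSOps α x y h) :
    ((∀ w, h 0 (x 0 w) = x 0 (h 0 w) + (2 : ℂ) • x 0 w) ∧
      (∀ w, h 0 (x 1 w) = x 1 (h 0 w) - x 1 w) ∧ (∀ w, h 0 (x 2 w) = x 2 (h 0 w) - x 2 w)) ∧
    ((∀ w, h 1 (x 0 w) = x 0 (h 1 w) + (-1 + α) • x 0 w) ∧ (∀ w, h 1 (x 1 w) = x 1 (h 1 w)) ∧
      (∀ w, h 1 (x 2 w) = x 2 (h 1 w) + x 2 w)) ∧
    ((∀ w, h 2 (x 0 w) = x 0 (h 2 w) + (-1 - α) • x 0 w) ∧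
      (∀ w, h 2 (x 1 w) = x 1 (h 2 w) + x 1 w) ∧ (∀ w, h 2 (x 2 w) = x 2 (h 2 w))) := by
  refine ⟨⟨?_, ?_, ?_⟩, ⟨?_, ?_, ?_⟩, ⟨?_, ?_, ?_⟩⟩ <;> intro w <;> rw [T.hx] <;>
    simp [cartanS, sub_eq_add_neg]

theorem isSlTwoOps_zero (T : IsSOps α x y h) : IsSlTwoOps (x 0) (y 0) (h 0) :=
  ⟨T.h_x.1.1, T.h_y.1.1, T.x_y.1.1⟩

theorem isSlTwoOps_one_two (T : IsSOps α x y h) :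
    IsSlTwoOps (x 1 * x 2 + x 2 * x 1) (-(y 1 * y 2 + y 2 * y 1)) (h 1 + h 2) := by
  obtain ⟨⟨a00, a01, a02⟩, ⟨a10, a11, a12⟩, ⟨a20, a21, a22⟩⟩ := T.x_y
  obtain ⟨⟨b00, b01, b02⟩, ⟨b10, b11, b12⟩, ⟨b20, b21, b22⟩⟩ := T.h_y
  obtain ⟨⟨c00, c01, c02⟩, ⟨c10, c11, c12⟩, ⟨c20, c21, c22⟩⟩ := T.h_x
  constructor <;> intro w <;>
    simp only [Module.End.mul_apply, LinearMap.add_apply, LinearMap.neg_apply, map_add, map_sub,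
      map_neg, a11, a12, a21, a22, b11, b12, b21, b22, c11, c12, c21, c22] <;>
    module

/-- The only critical commutator is that of X₂ with Y₂², which is [h₂, Y₂] = 0 because α₂ is
isotropic. -/
theorem x_y_one_sq (T : IsSOps α x y h) (i : Fin 3) (w : V) :
    x i ((y 1 * y 1) w) = (y 1 * y 1) (x i w) := by
  obtain ⟨⟨a00, a01, a02⟩, ⟨a10, a11, a12⟩, ⟨a20, a21, a22⟩⟩ := T.x_y
  obtain ⟨⟨b00, b01, b02⟩, ⟨b10, b11, b12⟩, ⟨b20, b21, b22⟩⟩ := T.h_y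
  fin_cases i <;>
    simp only [Fin.zero_eta, Fin.mk_one, Fin.reduceFinMk, Module.End.mul_apply, map_add, map_neg,
      a01, a11, a21, b11] <;> module

theorem x_one_sq_y (T : IsSOps α x y h) (i : Fin 3) (w : V) :
    (x 1 * x 1) (y i w) = y i ((x 1 * x 1) w) := by
  obtain ⟨⟨a00, a01, a02⟩, ⟨a10, a11, a12⟩, ⟨a20, a21, a22⟩⟩ := T.x_y
  obtain ⟨⟨c00, c01, c02⟩, ⟨c10, c11, c12⟩, ⟨c20, c21, c22⟩⟩ := T.h_x
  fin_cases i <;>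
    simp only [Fin.zero_eta, Fin.mk_one, Fin.reduceFinMk, Module.End.mul_apply, map_add, map_neg,
      a10, a11, a12, c11] <;> module

-- For X₁ this is the usual Serre computation with a₁₂ = -1. Bracketing with X₂ turns the inner [Y₁,
-- Y₂] into a multiple of Y₁, which commutes with the outer Y₁.
set_option linter.unusedSimpArgs false in
theorem x_serre_one (T : IsSOps α x y h) (i : Fin 3) (w : V) :
    x i ((y 0 * (y 0 * y 1 - y 1 * y 0) - (y 0 * y 1 - y 1 * y 0) * y 0) w) =
      superSign (parityS i) 1 •
        (y 0 * (y 0 * y 1 - y 1 * y 0) - (y 0 * y 1 - y 1 * y 0) * y 0) (x i w) := by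
  obtain ⟨⟨a00, a01, a02⟩, ⟨a10, a11, a12⟩, ⟨a20, a21, a22⟩⟩ := T.x_y
  obtain ⟨⟨b00, b01, b02⟩, ⟨b10, b11, b12⟩, ⟨b20, b21, b22⟩⟩ := T.h_y
  fin_cases i <;>
    simp [superSign, parityS, a00, a10, a20, a01, a11, a21, b00, b10, b20, b01, b11, b21] <;> module


/-- The element `[F, q]`, where `F = [Y₂, Y₃]` and
`q = (-1 + α) [F, Y₁] - 2 [Y₃, [Y₁, Y₂]]`. -/
def auxOp (α : ℂ) (y : Fin 3 → Module.End ℂ V) : Module.End ℂ V :=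
  (y 1 * y 2 + y 2 * y 1) *
      ((-1 + α) • ((y 1 * y 2 + y 2 * y 1) * y 0 - y 0 * (y 1 * y 2 + y 2 * y 1)) +
        (-2 : ℂ) • (y 2 * (y 0 * y 1 - y 1 * y 0) + (y 0 * y 1 - y 1 * y 0) * y 2)) -
    ((-1 + α) • ((y 1 * y 2 + y 2 * y 1) * y 0 - y 0 * (y 1 * y 2 + y 2 * y 1)) +
        (-2 : ℂ) • (y 2 * (y 0 * y 1 - y 1 * y 0) + (y 0 * y 1 - y 1 * y 0) * y 2)) *
      (y 1 * y 2 + y 2 * y 1)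

/-- The element `[F, [F, [Y₁, Y₂]]]`, where `F = [Y₂, Y₃]`. -/
def serreOp (y : Fin 3 → Module.End ℂ V) : Module.End ℂ V :=
  (y 1 * y 2 + y 2 * y 1) * ((y 1 * y 2 + y 2 * y 1) * (y 0 * y 1 - y 1 * y 0) -
      (y 0 * y 1 - y 1 * y 0) * (y 1 * y 2 + y 2 * y 1)) -
    ((y 1 * y 2 + y 2 * y 1) * (y 0 * y 1 - y 1 * y 0) -
      (y 0 * y 1 - y 1 * y 0) * (y 1 * y 2 + y 2 * y 1)) * (y 1 * y 2 + y 2 * y 1)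

-- With F and q as in `auxOp`: [X₁, q] = -2αF commutes with F. For X₂ one has [X₂, F] = -Y₃ and [X₂,
-- q] = (α - 1)[Y₃, Y₁], and the two resulting contributions to [X₂, [F, q]] cancel because F
-- commutes with Y₃ and Y₃² = 0.
set_option linter.unusedSimpArgs false in
theorem x_auxOp (T : IsSOps α x y h) (hy1 : ∀ w, y 1 (y 1 w) = 0) (hy2 : ∀ w, y 2 (y 2 w) = 0)
    (i : Fin 3) (w : V) : x i (auxOp α y w) = auxOp α y (x i w) := by
  obtain ⟨⟨a00, a01, a02⟩, ⟨a10, a11, a12⟩, ⟨a20, a21, a22⟩⟩ := T.x_y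
  obtain ⟨⟨b00, b01, b02⟩, ⟨b10, b11, b12⟩, ⟨b20, b21, b22⟩⟩ := T.h_y
  fin_cases i <;>
    simp only [auxOp, Fin.zero_eta, Fin.mk_one, Fin.reduceFinMk, Module.End.mul_apply,
      LinearMap.add_apply, LinearMap.sub_apply, LinearMap.smul_apply, map_add, map_sub, map_neg,
      map_smul, map_zero, a00, a01, a02, a10, a11, a12, a20, a21, a22,
      b00, b01, b02, b10, b11, b12, b20, b21, b22, hy1, hy2] <;> module

-- Let P = [Y₁, Y₂]. Since [X₂, F] = -Y₃, [X₂, P] = (α - 1)Y₁, and F commutes with Y₃, bracketing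
-- [F, [F, P]] with X₂ gives exactly [F, q]; this is where q comes from. The brackets with X₁ and X₃
-- vanish because F commutes with Y₂ and [Y₂, P] = 0.
set_option linter.unusedSimpArgs false in
theorem x_serreOp (T : IsSOps α x y h) (hy1 : ∀ w, y 1 (y 1 w) = 0) (hy2 : ∀ w, y 2 (y 2 w) = 0)
    (hu : auxOp α y = 0)
    (i : Fin 3) (w : V) : x i (serreOp y w) = superSign (parityS i) 1 • serreOp y (x i w) := by
  obtain ⟨⟨a00, a01, a02⟩, ⟨a10, a11, a12⟩, ⟨a20, a21, a22⟩⟩ := T.x_y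
  obtain ⟨⟨b00, b01, b02⟩, ⟨b10, b11, b12⟩, ⟨b20, b21, b22⟩⟩ := T.h_y
  have h0 : superSign (parityS 0) 1 = 1 := by simp [superSign, parityS]
  have h1 : superSign (parityS 1) 1 = -1 := by simp [superSign, parityS]
  have h2 : superSign (parityS 2) 1 = -1 := by simp [superSign, parityS]
  have hu' : (0 : V) = auxOp α y w := by rw [hu]; rfl
  fin_cases i
  · simp only [serreOp, Fin.zero_eta, Fin.mk_one, Fin.reduceFinMk, Module.End.mul_apply,
      LinearMap.add_apply, LinearMap.sub_apply, LinearMap.smul_apply, map_add, map_sub, map_neg,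
      map_smul, map_zero, a00, a01, a02, a10, a11, a12, a20, a21, a22,
      b00, b01, b02, b10, b11, b12, b20, b21, b22, hy1, hy2, h0]
    module
  -- The defect for X₂ is precisely `auxOp`, so it is inserted here in the guise of zero.
  · rw [← add_zero (superSign _ _ • _), hu']
    simp only [serreOp, auxOp, Fin.zero_eta, Fin.mk_one, Fin.reduceFinMk, Module.End.mul_apply,
      LinearMap.add_apply, LinearMap.sub_apply, LinearMap.smul_apply, map_add, map_sub, map_neg,
      map_smul, map_zero, a00, a01, a02, a10, a11, a12, a20, a21, a22,
      b00, b01, b02, b10, b11, b12, b20, b21, b22, hy1, hy2, h1]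
    module
  · simp only [serreOp, Fin.zero_eta, Fin.mk_one, Fin.reduceFinMk, Module.End.mul_apply,
      LinearMap.add_apply, LinearMap.sub_apply, LinearMap.smul_apply, map_add, map_sub, map_neg,
      map_smul, map_zero, a00, a01, a02, a10, a11, a12, a20, a21, a22,
      b00, b01, b02, b10, b11, b12, b20, b21, b22, hy1, hy2, h2]
    module

/-- The commutation relations of `-[Y₂, Y₃]`, symmetric in the two odd simple roots. -/
theorem commutation (T : IsSOps α x y h) (hy1 : ∀ w, y 1 (y 1 w) = 0)
    (hy2 : ∀ w, y 2 (y 2 w) = 0) {i j : Fin 3} (hij : i = 1 ∧ j = 2 ∨ i = 2 ∧ j = 1) :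
    (∀ w, x 0 ((-(y 1 * y 2 + y 2 * y 1)) w) = (-(y 1 * y 2 + y 2 * y 1)) (x 0 w)) ∧
    (∀ w, x i ((-(y 1 * y 2 + y 2 * y 1)) w) = (-(y 1 * y 2 + y 2 * y 1)) (x i w) + y j w) ∧
    (∀ w, y i ((-(y 1 * y 2 + y 2 * y 1)) w) = (-(y 1 * y 2 + y 2 * y 1)) (y i w)) := by
  obtain ⟨⟨a00, a01, a02⟩, ⟨a10, a11, a12⟩, ⟨a20, a21, a22⟩⟩ := T.x_y
  obtain ⟨⟨b00, b01, b02⟩, ⟨b10, b11, b12⟩, ⟨b20, b21, b22⟩⟩ := T.h_y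
  rcases hij with ⟨rfl, rfl⟩ | ⟨rfl, rfl⟩ <;> refine ⟨fun w => ?_, fun w => ?_, fun w => ?_⟩ <;>
    simp only [Module.End.mul_apply, LinearMap.add_apply, LinearMap.neg_apply, map_add, map_neg,
      map_zero, a01, a02, a11, a12, a21, a22, b12, b21, hy1, hy2] <;> module

/-- This recovers Y₁ from [Y₁, Y₂] when α ≠ 1. -/
theorem x_one_bracket (T : IsSOps α x y h) (w : V) :
    x 1 ((y 0 * y 1 - y 1 * y 0) w) + (y 0 * y 1 - y 1 * y 0) (x 1 w) = (-1 + α) • y 0 w := by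
  obtain ⟨-, ⟨a10, a11, -⟩, -⟩ := T.x_y
  simp only [Module.End.mul_apply, LinearMap.sub_apply, map_add, map_sub, map_neg, a10, a11,
    T.h_y.2.1.1]
  module

end IsSOps

/-- If `c = [x, g]` commutes with `g`, then `x g^{k+1} = g^{k+1} x + (k+1) g^k c`. -/
theorem apply_pow_succ_of_commutator {x g c : Module.End ℂ V} (hx : ∀ w, x (g w) = g (x w) + c w)
    (hc : ∀ w, c (g w) = g (c w)) (k : ℕ) (w : V) :
    x ((g ^ (k + 1)) w) = (g ^ (k + 1)) (x w) + ((k : ℂ) + 1) • (g ^ k) (c w) := by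
  have hc' : ∀ (k : ℕ) (w : V), c ((g ^ k) w) = (g ^ k) (c w) := by
    intro k w
    induction k with
    | zero => simp
    | succ k ih => rw [pow_succ', Module.End.mul_apply, hc, ih, Module.End.mul_apply]
  induction k with
  | zero => simp [hx]
  | succ k ih =>
    rw [pow_succ' g (k + 1), Module.End.mul_apply, hx, ih, hc', map_add, map_smul,
      ← Module.End.mul_apply g (g ^ k), ← pow_succ', Module.End.mul_apply]
    push_cast
    module

theorem apply_pow_of_commute {x g : Module.End ℂ V} (hx : ∀ w, x (g w) = g (x w)) (k : ℕ) (w : V) :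
    x ((g ^ k) w) = (g ^ k) (x w) := by
  induction k with
  | zero => simp
  | succ k ih => rw [pow_succ', Module.End.mul_apply, hx, ih, Module.End.mul_apply]

end OperatorRelations

/-! ### Local nilpotency in irreducible highest weight modules of `S(1,2,α)` -/

theorem eq_one_or_eq_two : ∀ {i : Fin 3}, i ≠ 0 → i = 1 ∨ i = 2 := by decide

theorem odd_pair_properties : ∀ {i j : Fin 3}, (i = 1 ∧ j = 2 ∨ i = 2 ∧ j = 1) →
    (i ≠ 0 ∧ j ≠ 0 ∧ i ≠ j) ∧ ∀ l, l = 0 ∨ l = i ∨ l = j := by decide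

namespace Realization

variable {α : ℂ} {H : Type*} [AddCommGroup H] [Module ℂ H] {R : Realization (cartanS α) H}
  {V : Type*} [AddCommGroup V] [Module ℂ V] {M : (R.contragredient parityS).Rep V}

theorem isSOps : IsSOps α (R.opX parityS M) (R.opY parityS M)
    (fun i => R.opH parityS M (R.coroot i)) where
  xy i j w := opX_opY M i j w
  hx i j w := by rw [opH_opX, R.root_coroot]
  hy i j w := by rw [opH_opY, R.root_coroot]

variable (R M) in
/-- The action of `-[Y₂, Y₃]`. -/
noncomputable def lowOp : Module.End ℂ V :=
  -(R.opY parityS M 1 * R.opY parityS M 2 + R.opY parityS M 2 * R.opY parityS M 1)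

variable (R M) in
/-- The action of `[X₂, X₃]`. -/
noncomputable def raiseOp : Module.End ℂ V :=
  R.opX parityS M 1 * R.opX parityS M 2 + R.opX parityS M 2 * R.opX parityS M 1

theorem isWeightOp_raiseOp :
    R.IsWeightOp parityS M (1 + 1) (R.root 1 + R.root 2) (R.raiseOp M) := by
  have := (IsWeightOp.opX (R := R) (M := M) 1).bracket 1 (IsWeightOp.opX 2)
  rwa [one_smul] at this

theorem isWeightOp_lowOp :
    R.IsWeightOp parityS M (1 + 1) (-(R.root 1 + R.root 2)) (R.lowOp M) := by
  have := ((IsWeightOp.opY (R := R) (M := M) 1).bracket 1 (IsWeightOp.opY 2)).smul (-1)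
  rwa [one_smul, neg_one_smul, ← neg_add] at this

theorem isSlTwoOps_lowOp :
    IsSlTwoOps (R.raiseOp M) (R.lowOp M) (R.opH parityS M (R.coroot 1 + R.coroot 2)) := by
  rw [opH_add]
  exact isSOps.isSlTwoOps_one_two

namespace IsHighestVector

variable {lam : Module.Dual ℂ H} {v : V} {d : H}

theorem opY_opY_eq_zero (hv : R.IsHighestVector parityS M lam v) (hd : ∀ i, R.root i d = 1)
    {i : Fin 3} (hi : i ≠ 0) (w : V) : R.opY parityS M i (R.opY parityS M i w) = 0 := by
  have h : R.opY parityS M i * R.opY parityS M i = 0 := by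
    refine hv.eq_zero_of_weight_neg hd ((IsWeightOp.opY i).mul (IsWeightOp.opY i)) (k := 2)
      two_pos ?_ fun j => ⟨1, fun w => ?_⟩
    · simp [hd]; norm_num
    · rw [one_smul]
      have T := isSOps (R := R) (M := M)
      obtain rfl | rfl : i = 1 ∨ i = 2 := eq_one_or_eq_two hi
      · exact T.x_y_one_sq j w
      · have := T.swap.x_y_one_sq (Equiv.swap 1 2 j) w
        simpa only [Function.comp_apply, Equiv.swap_apply_self, Equiv.swap_apply_left] using this
  exact LinearMap.congr_fun h w

/-- Here the vanishing is propagated from v by commutation with the lowering operators; a depth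
argument is not available for raising operators. -/
theorem opX_opX_eq_zero (hv : R.IsHighestVector parityS M lam v)
    {i : Fin 3} (hi : i ≠ 0) (w : V) : R.opX parityS M i (R.opX parityS M i w) = 0 := by
  have h : R.opX parityS M i * R.opX parityS M i = 0 := by
    refine hv.eq_zero_of_apply_eq_zero (by simp [hv.opX_eq]) fun j => ⟨1, fun w => ?_⟩
    rw [one_smul]
    have T := isSOps (R := R) (M := M)
    obtain rfl | rfl : i = 1 ∨ i = 2 := eq_one_or_eq_two hi
    · exact T.x_one_sq_y j w
    · have := T.swap.x_one_sq_y (Equiv.swap 1 2 j) w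
      simpa only [Function.comp_apply, Equiv.swap_apply_self, Equiv.swap_apply_left] using this
  exact LinearMap.congr_fun h w

theorem serre_eq_zero (hv : R.IsHighestVector parityS M lam v) (hd : ∀ i, R.root i d = 1)
    {i : Fin 3} (hi : i ≠ 0) :
    R.opY parityS M 0 *
      (R.opY parityS M 0 * R.opY parityS M i - R.opY parityS M i * R.opY parityS M 0) -
    (R.opY parityS M 0 * R.opY parityS M i - R.opY parityS M i * R.opY parityS M 0) *
      R.opY parityS M 0 = 0 := by
  have hz := (IsWeightOp.opY (R := R) (M := M) 0).bracket (-1)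
    ((IsWeightOp.opY 0).bracket (-1) (IsWeightOp.opY i))
  simp only [neg_one_smul, ← sub_eq_add_neg] at hz
  refine hv.eq_zero_of_weight_neg hd hz (k := 3) three_pos ?_
    fun j => ⟨superSign (parityS j) 1, fun w => ?_⟩
  · simp [hd]; norm_num
  · have T := isSOps (R := R) (M := M)
    obtain rfl | rfl : i = 1 ∨ i = 2 := eq_one_or_eq_two hi
    · exact T.x_serre_one j w
    · have := T.swap.x_serre_one (Equiv.swap 1 2 j) w
      have hp : parityS (Equiv.swap 1 2 j) = parityS j := by fin_cases j <;> rfl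
      simpa only [Function.comp_apply, Equiv.swap_apply_self, Equiv.swap_apply_left, hp,
        Equiv.swap_apply_of_ne_of_ne (show (0 : Fin 3) ≠ 1 by decide)
          (show (0 : Fin 3) ≠ 2 by decide)] using this

theorem auxOp_eq_zero (hv : R.IsHighestVector parityS M lam v) (hd : ∀ i, R.root i d = 1) :
    IsSOps.auxOp α (R.opY parityS M) = 0 := by
  have y := IsWeightOp.opY (R := R) (M := M)
  have hF := (y 1).bracket 1 (y 2)
  have hq := ((hF.bracket (-1) (y 0)).smul (-1 + α))
  have hq' := (((y 2).bracket 1 ((y 0).bracket (-1) (y 1))).smul (-2))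
  have e : parityS 2 + (parityS 0 + parityS 1) = parityS 1 + parityS 2 + parityS 0 := by decide
  have e' : -R.root 2 + (-R.root 0 + -R.root 1) = -R.root 1 + -R.root 2 + -R.root 0 := by abel
  rw [e, e'] at hq'
  have hz := hF.bracket (-1) (hq.add hq')
  simp only [neg_one_smul, one_smul, ← sub_eq_add_neg] at hz
  refine hv.eq_zero_of_weight_neg hd hz (k := 5) (by norm_num) ?_ fun j => ⟨1, fun w => ?_⟩
  · simp [hd]; norm_num
  · rw [one_smul]
    exact isSOps.x_auxOp (hv.opY_opY_eq_zero hd (by decide))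
      (hv.opY_opY_eq_zero hd (by decide)) j w

theorem serreOp_eq_zero (hv : R.IsHighestVector parityS M lam v) (hd : ∀ i, R.root i d = 1) :
    IsSOps.serreOp (R.opY parityS M) = 0 := by
  have y := IsWeightOp.opY (R := R) (M := M)
  have hF := (y 1).bracket 1 (y 2)
  have hz := hF.bracket (-1) (hF.bracket (-1) ((y 0).bracket (-1) (y 1)))
  simp only [neg_one_smul, one_smul, ← sub_eq_add_neg] at hz
  refine hv.eq_zero_of_weight_neg hd hz (k := 6) (by norm_num) ?_
    fun j => ⟨superSign (parityS j) 1, fun w => ?_⟩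
  · simp [hd]; norm_num
  · exact isSOps.x_serreOp (hv.opY_opY_eq_zero hd (by decide))
      (hv.opY_opY_eq_zero hd (by decide)) (hv.auxOp_eq_zero hd) j w

/-- Since the Yᵢ generate V from v, nilpotency has to be checked at v and shown to be inherited
under each Yᵢ. -/
theorem locallyNilpotent_of_opY (hv : R.IsHighestVector parityS M lam v) {f : Module.End ℂ V}
    (hf : v ∈ locallyNilpotentSubspace f)
    (hY : ∀ i, locallyNilpotentSubspace f ≤
      (locallyNilpotentSubspace f).comap (R.opY parityS M i)) (w : V) : ∃ N, (f ^ N) w = 0 := by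
  have h : (⊤ : Submodule ℂ V) ≤ locallyNilpotentSubspace f := by
    rw [← hv.lowerSpan_eq_top]
    exact lowerSpan_le (by rintro s rfl; exact hf) fun i w hw => hY i hw
  exact h (Submodule.mem_top (x := w))

/-- The vector Y₁^(m+1) v is singular because λ₁ = m, hence zero; the relations [Y₁, [Y₁, Yᵢ]] = 0
spread nilpotency to V. -/
theorem opY_zero_locallyNilpotent (hv : R.IsHighestVector parityS M lam v)
    (hd : ∀ i, R.root i d = 1) {m : ℕ} (hm : lam (R.coroot 0) = m) (w : V) :
    ∃ N, (R.opY parityS M 0 ^ N) w = 0 := by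
  have T := isSOps (R := R) (M := M)
  refine hv.locallyNilpotent_of_opY ⟨m + 1, ?_⟩ (fun i => ?_) w
  · refine hv.eq_zero_of_singular hd (ν := lam + ((m + 1 : ℕ) : ℂ) • -R.root 0) (k := m + 1)
      (fun a => ?_) (fun i => ?_) m.succ_pos ?_
    · exact (IsWeightOp.opY 0).opH_pow_apply_of_eq (hv.opH_eq a) (m + 1)
    · fin_cases i
      · have := T.isSlTwoOps_zero.e_pow_succ_f (hv.opH_eq _) (hv.opX_eq 0) m
        rw [hm, sub_self, mul_zero, zero_smul] at this
        exact this
      · exact (apply_pow_of_commute T.x_y.2.1.1 _ _).trans (by rw [hv.opX_eq, map_zero])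
      · exact (apply_pow_of_commute T.x_y.2.2.1 _ _).trans (by rw [hv.opX_eq, map_zero])
    · simp [hd]; ring
  · by_cases hi : i = 0
    · subst hi
      exact locallyNilpotentSubspace_le_comap_of_commute rfl
    · exact locallyNilpotentSubspace_le_comap (locallyNilpotentSubspace_le_comap_of_commute
        (sub_eq_zero.1 (hv.serre_eq_zero hd hi)))

/-- The odd Yᵢ commute with g, and the commutator of g with an odd Xᵢ is minus the other odd Y.
Preservation under the Xᵢ is what later allows Y₁ and v to be recovered. -/
theorem comap_lowOp (hv : R.IsHighestVector parityS M lam v) (hd : ∀ i, R.root i d = 1)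
    {i : Fin 3} (hi : i ≠ 0) :
    (locallyNilpotentSubspace (R.lowOp M) ≤
      (locallyNilpotentSubspace (R.lowOp M)).comap (R.opY parityS M i)) ∧
    (locallyNilpotentSubspace (R.lowOp M) ≤
      (locallyNilpotentSubspace (R.lowOp M)).comap (R.opX parityS M i)) := by
  have hy : ∀ {i j : Fin 3}, (i = 1 ∧ j = 2 ∨ i = 2 ∧ j = 1) → _ :=
    isSOps.commutation (hv.opY_opY_eq_zero hd (by decide)) (hv.opY_opY_eq_zero hd (by decide))
  have hY : ∀ {i j : Fin 3}, (i = 1 ∧ j = 2 ∨ i = 2 ∧ j = 1) →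
      locallyNilpotentSubspace (R.lowOp M) ≤
      (locallyNilpotentSubspace (R.lowOp M)).comap (R.opY parityS M i) := fun hij =>
    locallyNilpotentSubspace_le_comap_of_commute (LinearMap.ext fun w => ((hy hij).2.2 w).symm)
  have key : ∀ {i j : Fin 3}, (i = 1 ∧ j = 2 ∨ i = 2 ∧ j = 1) →
      locallyNilpotentSubspace (R.lowOp M) ≤
      (locallyNilpotentSubspace (R.lowOp M)).comap (R.opX parityS M i) := by
    intro i j hij
    refine locallyNilpotentSubspace_le_comap ?_
    have h1 : R.lowOp M * R.opX parityS M i - R.opX parityS M i * R.lowOp M =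
        -R.opY parityS M j := by
      ext w
      have := (hy hij).2.1 w
      simp only [LinearMap.sub_apply, Module.End.mul_apply, LinearMap.neg_apply]
      rw [lowOp, this]
      abel
    rw [h1]
    intro w hw
    rw [Submodule.mem_comap, LinearMap.neg_apply]
    exact neg_mem (hY (i := j) (j := i) (by tauto) hw)
  obtain rfl | rfl : i = 1 ∨ i = 2 := eq_one_or_eq_two hi
  · exact ⟨hY (j := 2) (by decide), key (j := 2) (by decide)⟩
  · exact ⟨hY (j := 1) (by decide), key (j := 1) (by decide)⟩

/-- The relation [F, [F, [Y₁, Y₂]]] = 0 shows that [Y₁, Y₂] preserves the subspace. So does X₂, and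
their bracket is (α - 1)Y₁. This route avoids any direct relation between g and Y₁. -/
theorem comap_lowOp_zero (hv : R.IsHighestVector parityS M lam v) (hd : ∀ i, R.root i d = 1)
    (hα : α ≠ 1) : locallyNilpotentSubspace (R.lowOp M) ≤
      (locallyNilpotentSubspace (R.lowOp M)).comap (R.opY parityS M 0) := by
  have hx := (hv.comap_lowOp hd (i := 1) (by decide)).2
  have hY : locallyNilpotentSubspace (R.lowOp M) ≤ (locallyNilpotentSubspace (R.lowOp M)).comap
      (R.opY parityS M 0 * R.opY parityS M 1 - R.opY parityS M 1 * R.opY parityS M 0) := by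
    refine locallyNilpotentSubspace_le_comap (locallyNilpotentSubspace_le_comap_of_commute ?_)
    have := hv.serreOp_eq_zero hd
    rw [IsSOps.serreOp, sub_eq_zero] at this
    have key : ∀ F P : Module.End ℂ V, F * (F * P - P * F) = (F * P - P * F) * F →
        -F * (-F * P - P * -F) = (-F * P - P * -F) * -F := by
      intro F P h
      have h1 : -F * P - P * -F = -(F * P - P * F) := by noncomm_ring
      rw [h1, neg_mul_neg, neg_mul_neg, h]
    exact key _ _ this
  intro w hw
  have h1 := (isSOps (R := R) (M := M)).x_one_bracket w
  have h2 : (-1 + α) • R.opY parityS M 0 w ∈ locallyNilpotentSubspace (R.lowOp M) :=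
    h1 ▸ add_mem (hx (hY hw)) (hY (hx hw))
  have hne : -1 + α ≠ 0 := fun h => hα (by linear_combination h)
  exact (Submodule.smul_mem_iff (locallyNilpotentSubspace (R.lowOp M)) hne).1 h2

end IsHighestVector

end Realization

/-! ### The operator [Y₂, Y₃] on the highest weight vector -/

namespace Realization

variable {α : ℂ} {H : Type*} [AddCommGroup H] [Module ℂ H] {R : Realization (cartanS α) H}
  {V : Type*} [AddCommGroup V] [Module ℂ V] {M : (R.contragredient parityS).Rep V}

namespace IsHighestVector

variable {lam : Module.Dual ℂ H} {v : V} {d : H}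

/-- The vector `Yᵢ v` for an odd simple root `αᵢ` is primitive for the `sl₂`-triple of `α₂ + α₃`. -/
theorem opH_opY_highest (hv : R.IsHighestVector parityS M lam v) {i : Fin 3} (hi : i ≠ 0) :
    R.opH parityS M (R.coroot 1 + R.coroot 2) (R.opY parityS M i v) =
      (lam (R.coroot 1) + lam (R.coroot 2) - 1) • R.opY parityS M i v := by
  rw [(IsWeightOp.opY i).opH_apply_of_eq (hv.opH_eq _), LinearMap.neg_apply, map_add, map_add,
    R.root_coroot, R.root_coroot]
  congr 1
  obtain rfl | rfl := eq_one_or_eq_two hi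
  all_goals simp [cartanS]; ring

theorem opX_opY_highest (hv : R.IsHighestVector parityS M lam v) (i j : Fin 3) :
    R.opX parityS M i (R.opY parityS M j v) = if i = j then lam (R.coroot i) • v else 0 := by
  rw [opX_opY, hv.opX_eq, hv.opH_eq, map_zero, smul_zero, zero_add]

theorem raiseOp_opY_highest (hv : R.IsHighestVector parityS M lam v) {i : Fin 3} :
    R.raiseOp M (R.opY parityS M i v) = 0 := by
  simp only [raiseOp, LinearMap.add_apply, Module.End.mul_apply, hv.opX_opY_highest]
  split_ifs <;> simp [hv.opX_eq]

theorem opY_highest_ne_zero (hv : R.IsHighestVector parityS M lam v) {i : Fin 3}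
    (hl : lam (R.coroot i) ≠ 0) : R.opY parityS M i v ≠ 0 := by
  intro h
  have := hv.opX_opY_highest i i
  rw [h, map_zero, if_pos rfl, eq_comm, smul_eq_zero] at this
  exact this.elim hl hv.ne_zero

/-- Singularity of u = g^(m+1) Yᵢv is reached in two stages. `sl₂`-theory gives Eu = 0, while X₁ and
Xⱼ kill u directly. Then Xᵢu is killed by every X, with XⱼXᵢu = Eu - XᵢXⱼu = 0, so it is a singular
vector of lower weight and vanishes. Hence u itself is singular. -/
theorem lowOp_pow_eq_zero (hv : R.IsHighestVector parityS M lam v)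
    (hd : ∀ i, R.root i d = 1) {i j : Fin 3} (hij : i = 1 ∧ j = 2 ∨ i = 2 ∧ j = 1) {m : ℕ}
    (hm : lam (R.coroot 1) + lam (R.coroot 2) - 1 = m) :
    (R.lowOp M ^ (m + 1)) (R.opY parityS M i v) = 0 := by
  have hy : ∀ {i j : Fin 3}, (i = 1 ∧ j = 2 ∨ i = 2 ∧ j = 1) → _ :=
    (isSOps (R := R) (M := M)).commutation (hv.opY_opY_eq_zero hd (by decide))
      (hv.opY_opY_eq_zero hd (by decide))
  have hij' : j = 1 ∧ i = 2 ∨ j = 2 ∧ i = 1 := by tauto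
  obtain ⟨⟨hi0, hj0, hne⟩, hcases⟩ := odd_pair_properties hij
  set u := (R.lowOp M ^ (m + 1)) (R.opY parityS M i v) with hu
  have hE : R.raiseOp M u = 0 := by
    have := isSlTwoOps_lowOp.e_pow_succ_f (hv.opH_opY_highest hi0) hv.raiseOp_opY_highest m
    rwa [hm, sub_self, mul_zero, zero_smul] at this
  have h0 : R.opX parityS M 0 u = 0 := by
    refine (apply_pow_of_commute (hy hij).1 _ _).trans ?_
    rw [hv.opX_opY_highest, if_neg hi0.symm, map_zero]
  have hj : R.opX parityS M j u = 0 := by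
    -- The commutator of Xⱼ with g is Yᵢ, and the extra term contains Yᵢ² = 0.
    refine (apply_pow_succ_of_commutator (hy hij').2.1 (hy hij).2.2 _ _).trans ?_
    rw [hv.opX_opY_highest, if_neg hne.symm, hv.opY_opY_eq_zero hd hi0, map_zero, map_zero,
      smul_zero, add_zero]
  have hi : R.opX parityS M i u = (R.lowOp M ^ (m + 1)) (lam (R.coroot i) • v) +
      ((m : ℂ) + 1) • (R.lowOp M ^ m) (R.opY parityS M j (R.opY parityS M i v)) := by
    refine (apply_pow_succ_of_commutator (hy hij).2.1 (hy hij').2.2 _ _).trans ?_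
    rw [hv.opX_opY_highest, if_pos rfl]
    rfl
  have h0i : R.opX parityS M 0 (R.opX parityS M i u) = 0 := by
    have hc : ∀ k w, R.opX parityS M 0 ((R.lowOp M ^ k) w) =
        (R.lowOp M ^ k) (R.opX parityS M 0 w) := apply_pow_of_commute (hy hij).1
    have h1 : R.opX parityS M 0 (R.opY parityS M j (R.opY parityS M i v)) = 0 := by
      rw [opX_opY, hv.opX_opY_highest, if_neg hi0.symm, if_neg hj0.symm, map_zero, smul_zero,
        add_zero]
    simp only [hi, map_add, map_smul, hc, hv.opX_eq, h1, map_zero, smul_zero, add_zero]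
  have hji : R.opX parityS M j (R.opX parityS M i u) = 0 := by
    have h1 : R.raiseOp M u = R.opX parityS M i (R.opX parityS M j u) +
        R.opX parityS M j (R.opX parityS M i u) := by
      rcases hij with ⟨rfl, rfl⟩ | ⟨rfl, rfl⟩
      · rfl
      · rw [add_comm]; rfl
    rwa [hE, hj, map_zero, zero_add, eq_comm] at h1
  have hwu : ∀ a, R.opH parityS M a u =
      (lam + -R.root i + ((m + 1 : ℕ) : ℂ) • -(R.root 1 + R.root 2)) a • u := fun a =>
    isWeightOp_lowOp.opH_pow_apply_of_eq ((IsWeightOp.opY i).opH_apply_of_eq (hv.opH_eq a)) (m + 1)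
  have hxi : R.opX parityS M i u = 0 := by
    refine hv.eq_zero_of_singular hd (k := 2 * (m + 1))
      (ν := lam + -R.root i + ((m + 1 : ℕ) : ℂ) • -(R.root 1 + R.root 2) + R.root i)
      (fun a => (IsWeightOp.opX i).opH_apply_of_eq (hwu a)) (fun l => ?_) (by omega) ?_
    · rcases hcases l with rfl | rfl | rfl
      · exact h0i
      · exact hv.opX_opX_eq_zero hi0 u
      · exact hji
    · simp [hd]; ring
  refine hv.eq_zero_of_singular hd (k := 2 * (m + 1) + 1) hwu (fun l => ?_) (by omega) ?_
  · rcases hcases l with rfl | rfl | rfl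
    · exact h0
    · exact hxi
    · exact hj
  · simp [hd]; ring

/-- If λ₂ = λ₃ = 0, both Y₂v and Y₃v are singular, so gv = 0. Otherwise Yᵢv lies in the locally
nilpotent subspace for some λᵢ ≠ 0, and applying Xᵢ, which preserves it, yields λᵢv. -/
theorem lowOp_locallyNilpotent (hv : R.IsHighestVector parityS M lam v)
    (hd : ∀ i, R.root i d = 1) (hα : α ≠ 1)
    (h : (lam (R.coroot 1) = 0 ∧ lam (R.coroot 2) = 0) ∨
      ((lam (R.coroot 1) ≠ 0 ∨ lam (R.coroot 2) ≠ 0) ∧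
        ∃ m : ℕ, lam (R.coroot 1) + lam (R.coroot 2) - 1 = m)) (w : V) :
    ∃ N, (R.lowOp M ^ N) w = 0 := by
  refine hv.locallyNilpotent_of_opY ?_ (fun i => ?_) w
  · rcases h with ⟨h1, h2⟩ | ⟨h12, m, hm⟩
    · have key : ∀ i, i ≠ 0 → lam (R.coroot i) = 0 → R.opY parityS M i v = 0 := by
        intro i hi hl
        refine hv.eq_zero_of_singular hd (k := 1) (ν := lam + -R.root i)
          (fun a => (IsWeightOp.opY i).opH_apply_of_eq (hv.opH_eq a)) (fun l => ?_) one_pos ?_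
        · rw [hv.opX_opY_highest]
          split_ifs with hli
          · rw [hli, hl, zero_smul]
          · rfl
        · simp [hd]; ring
      refine ⟨1, ?_⟩
      simp [lowOp, key 1 (by decide) h1, key 2 (by decide) h2]
    · have key : ∀ {i j : Fin 3}, (i = 1 ∧ j = 2 ∨ i = 2 ∧ j = 1) → lam (R.coroot i) ≠ 0 →
          v ∈ locallyNilpotentSubspace (R.lowOp M) := by
        intro i j hij hl
        have hi0 := (odd_pair_properties hij).1.1
        have h1 := (hv.comap_lowOp hd hi0).2 ⟨m + 1, hv.lowOp_pow_eq_zero hd hij hm⟩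
        rw [Submodule.mem_comap, hv.opX_opY_highest, if_pos rfl] at h1
        exact (Submodule.smul_mem_iff _ hl).1 h1
      rcases h12 with h1 | h2
      · exact key (i := 1) (j := 2) (by decide) h1
      · exact key (i := 2) (j := 1) (by decide) h2
  · by_cases hi : i = 0
    · subst hi
      exact hv.comap_lowOp_zero hd hα
    · exact (hv.comap_lowOp hd hi).1

end IsHighestVector

/-! ### Real roots -/

variable (R) in
/-- A functional that vanishes on `h₁ + h₂ + h₃`, takes a nonzero integral value on `h₁` and an
integral value on `d`. -/
structure IsAffineReal (d : H) (β : Module.Dual ℂ H) : Prop where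
  central : β (R.coroot 0 + (R.coroot 1 + R.coroot 2)) = 0
  int_coroot : ∃ z : ℤ, z ≠ 0 ∧ β (R.coroot 0) = z
  int_height : ∃ z : ℤ, β d = z

variable (R) in
/-- The sum of the simple roots. -/
def delta : Module.Dual ℂ H := R.root 0 + (R.root 1 + R.root 2)

theorem delta_coroot_zero : R.delta (R.coroot 0) = 0 := by
  simp [delta, R.root_coroot, cartanS]; norm_num

theorem delta_central : R.delta (R.coroot 0 + (R.coroot 1 + R.coroot 2)) = 0 := by
  simp [delta, R.root_coroot, cartanS]; ring

theorem delta_height {d : H} (hd : ∀ i, R.root i d = 1) : R.delta d = 3 := by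
  simp [delta, hd]; norm_num

namespace IsAffineReal

variable {d : H} {β : Module.Dual ℂ H}

theorem neg (h : R.IsAffineReal d β) : R.IsAffineReal d (-β) := by
  obtain ⟨h1, ⟨z, hz, h2⟩, ⟨m, h3⟩⟩ := h
  exact ⟨by simp only [LinearMap.neg_apply, h1, neg_zero],
    ⟨-z, neg_ne_zero.2 hz, by simp [h2]⟩, ⟨-m, by simp [h3]⟩⟩

theorem add_delta (hd : ∀ i, R.root i d = 1) (h : R.IsAffineReal d β) (k : ℤ) :
    R.IsAffineReal d (β + (k : ℂ) • R.delta) := by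
  obtain ⟨h1, ⟨z, hz, h2⟩, ⟨m, h3⟩⟩ := h
  refine ⟨?_, ⟨z, hz, ?_⟩, ⟨m + k * 3, ?_⟩⟩ <;>
    rw [LinearMap.add_apply, LinearMap.smul_apply]
  · rw [h1, delta_central, smul_zero, add_zero]
  · rw [h2, delta_coroot_zero, smul_zero, add_zero]
  · rw [h3, delta_height hd]; push_cast; rfl

theorem delta_sub (hd : ∀ i, R.root i d = 1) (h : R.IsAffineReal d β) :
    R.IsAffineReal d (R.delta - β) := by
  have := h.neg.add_delta hd 1
  rwa [Int.cast_one, one_smul, neg_add_eq_sub] at this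

end IsAffineReal

namespace IsHighestVector

variable {lam : Module.Dual ℂ H} {v : V} {d : H}

/-- On functionals that vanish on h₁ + h₂ + h₃, the product of the two reflections is translation by
±β(h₁)δ, with sign determined by the order of the factors. -/
theorem hasBoundedStrings_of_add_delta (hv : R.IsHighestVector parityS M lam v)
    (hd : ∀ i, R.root i d = 1) (hy : ∀ w, ∃ N, (R.opY parityS M 0 ^ N) w = 0)
    (hg : ∀ w, ∃ N, (R.lowOp M ^ N) w = 0) {β : Module.Dual ℂ H}
    (hβ : β (R.coroot 0 + (R.coroot 1 + R.coroot 2)) = 0) {c : ℂ}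
    (hc : c = β (R.coroot 0) ∨ c = -β (R.coroot 0))
    (h : R.HasBoundedStrings parityS M (β + c • R.delta)) :
    R.HasBoundedStrings parityS M β := by
  have s1 := fun ν (hν : R.IsWeight parityS M ν) => hν.reflection
    (isSOps (R := R) (M := M)).isSlTwoOps_zero (IsWeightOp.opX 0) (IsWeightOp.opY 0)
    (hv.locallyNilpotent_of_pos hd (IsWeightOp.opX 0) (j := 1) one_pos (by simp [hd])) hy
  have s0 := fun ν (hν : R.IsWeight parityS M ν) => hν.reflection
    isSlTwoOps_lowOp isWeightOp_raiseOp isWeightOp_lowOp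
    (hv.locallyNilpotent_of_pos hd isWeightOp_raiseOp (j := 2) two_pos
      (by simp [hd]; norm_num)) hg
  have e1 : R.root 0 (R.coroot 1 + R.coroot 2) = -2 := by
    simp [R.root_coroot, cartanS]; ring
  have e2 : (R.root 1 + R.root 2) (R.coroot 0) = -2 := by
    simp [R.root_coroot, cartanS]; ring
  have e3 : R.root 0 (R.coroot 0) = 2 := by
    simp [R.root_coroot, cartanS]
  have e4 : (R.root 1 + R.root 2) (R.coroot 1 + R.coroot 2) = 2 := by
    simp [R.root_coroot, cartanS]; norm_num
  have e5 : β (R.coroot 1 + R.coroot 2) = -β (R.coroot 0) := by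
    rw [map_add] at hβ
    exact eq_neg_of_add_eq_zero_right hβ
  rcases hc with rfl | rfl
  · refine HasBoundedStrings.of_reflection s0 (HasBoundedStrings.of_reflection s1 ?_)
    convert h using 1
    simp only [LinearMap.sub_apply, LinearMap.smul_apply, e5, e2, delta, smul_eq_mul]
    module
  · refine HasBoundedStrings.of_reflection s1 (HasBoundedStrings.of_reflection s0 ?_)
    convert h using 1
    simp only [LinearMap.sub_apply, LinearMap.smul_apply, e5, e1, delta, smul_eq_mul]
    module

/-- Choosing the sign so that the translation is by |β(h₁)|δ raises the height by at least 3, since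
β(h₁) is a nonzero integer and δ has height 3. Repetition makes the height positive. -/
theorem hasBoundedStrings_of_isAffineReal (hv : R.IsHighestVector parityS M lam v)
    (hd : ∀ i, R.root i d = 1) (hy : ∀ w, ∃ N, (R.opY parityS M 0 ^ N) w = 0)
    (hg : ∀ w, ∃ N, (R.lowOp M ^ N) w = 0) {β : Module.Dual ℂ H} (hβ : R.IsAffineReal d β) :
    R.HasBoundedStrings parityS M β := by
  -- The number n bounds the remaining translations: the gain in height per step exceeds the unit by
  -- which n drops.
  have key : ∀ (n : ℕ) (β : Module.Dual ℂ H) (m : ℤ), R.IsAffineReal d β → β d = m → 0 < m + n →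
      R.HasBoundedStrings parityS M β := by
    intro n
    induction n with
    | zero => exact fun β m _ hm hpos => hv.hasBoundedStrings_of_pos hd (by simpa using hpos) hm
    | succ n ih =>
      intro β m hβ hm hpos
      obtain ⟨z, hz, hzβ⟩ := hβ.int_coroot
      refine hv.hasBoundedStrings_of_add_delta hd hy hg hβ.central (c := (|z| : ℤ)) ?_
        (ih _ (m + |z| * 3) (hβ.add_delta hd _) ?_ ?_)
      · rw [hzβ]
        rcases abs_choice z with h | h <;> rw [h] <;> simp
      · rw [LinearMap.add_apply, LinearMap.smul_apply, hm, delta_height hd]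
        push_cast; rfl
      · have := Int.one_le_abs hz
        push_cast at hpos
        omega
  obtain ⟨m, hm⟩ := hβ.int_height
  exact key (1 + m.natAbs) β m hβ hm (by omega)

end IsHighestVector

end Realization

/-! ### Bases of `S(1,2,α)` -/

namespace BaseData

variable {H : Type*} [AddCommGroup H] [Module ℂ H]

/-- Up to the scaling of its rows, the Cartan matrix of `b` is that of `S(1,2,t)`, with the even
simple root at `e` and the odd ones at `i` and `j`. -/
structure IsSBase (b : BaseData 3 H) (e i j : Fin 3) (t : ℂ) : Prop where
  ne_ei : e ≠ i
  ne_ej : e ≠ j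
  ne_ij : i ≠ j
  parity_e : b.parity e = 0
  parity_i : b.parity i = 1
  parity_j : b.parity j = 1
  inv_ne : ∀ m : ℤ, t * m ≠ 1
  rows : ∃ s p q : ℂ, s ≠ 0 ∧ p ≠ 0 ∧ q ≠ 0 ∧
    (b.cartan e e = s * 2 ∧ b.cartan e i = -s ∧ b.cartan e j = -s) ∧
    (b.cartan i e = p * (-1 + t) ∧ b.cartan i i = 0 ∧ b.cartan i j = p) ∧
    (b.cartan j e = q * (-1 - t) ∧ b.cartan j i = q ∧ b.cartan j j = 0)

theorem evenReflection_root_self (b : BaseData 3 H) {k : Fin 3} (hk : b.cartan k k ≠ 0) :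
    (b.evenReflection k).root k = -b.root k := by
  simp only [evenReflection]
  rw [mul_div_assoc, div_self hk]
  module

/-- The reflections on roots and on coroots are contragredient to each other, so all pairings are
preserved. -/
theorem cartan_evenReflection (b : BaseData 3 H) {k : Fin 3} (hk : b.cartan k k ≠ 0) (i j : Fin 3) :
    (b.evenReflection k).cartan i j = b.cartan i j := by
  simp only [cartan, evenReflection, LinearMap.sub_apply, LinearMap.smul_apply, map_sub, map_smul,
    smul_eq_mul] at hk ⊢
  field_simp
  ring

namespace IsSBase

variable {b : BaseData 3 H} {e i j : Fin 3} {t : ℂ}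

theorem symm (h : b.IsSBase e i j t) : b.IsSBase e j i (-t) where
  ne_ei := h.ne_ej
  ne_ej := h.ne_ei
  ne_ij := h.ne_ij.symm
  parity_e := h.parity_e
  parity_i := h.parity_j
  parity_j := h.parity_i
  inv_ne m hm := h.inv_ne (-m) (by push_cast; linear_combination hm)
  rows := by
    obtain ⟨s, p, q, hs, hp, hq, ⟨h1, h2, h3⟩, ⟨h4, h5, h6⟩, ⟨h7, h8, h9⟩⟩ := h.rows
    exact ⟨s, q, p, hs, hq, hp, ⟨h1, h3, h2⟩, ⟨by rw [h7]; ring, h9, h8⟩, ⟨by rw [h4]; ring, h6, h5⟩⟩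

theorem cases (h : b.IsSBase e i j t) (k : Fin 3) : k = e ∨ k = i ∨ k = j := by
  have h1 := h.ne_ei
  have h2 := h.ne_ej
  have h3 := h.ne_ij
  omega

theorem cartan_self_ne_zero (h : b.IsSBase e i j t) : b.cartan e e ≠ 0 := by
  obtain ⟨s, p, q, hs, hp, hq, ⟨h1, -⟩, -⟩ := h.rows
  rw [h1]
  exact mul_ne_zero hs two_ne_zero

theorem isIsotropic (h : b.IsSBase e i j t) : b.IsIsotropic i := by
  obtain ⟨s, p, q, -, -, -, -, ⟨-, h5, -⟩, -⟩ := h.rows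
  exact ⟨h5, h.parity_i⟩

/-- The entries of row i off the diagonal are p(t - 1) and p, both nonzero since t ≠ 1. -/
theorem isRegular (h : b.IsSBase e i j t) : b.IsRegular i := by
  obtain ⟨s, p, q, hs, hp, hq, -, ⟨h4, h5, h6⟩, -⟩ := h.rows
  intro k hk h0
  rcases h.cases k with rfl | rfl | rfl
  · rw [h4] at h0
    have := (mul_eq_zero.1 h0).resolve_left hp
    exact absurd (by push_cast; linear_combination this) (h.inv_ne 1)
  · exact absurd rfl hk
  · exact absurd (h6 ▸ h0) hp

theorem evenReflection (h : b.IsSBase e i j t) : (b.evenReflection e).IsSBase e i j t where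
  ne_ei := h.ne_ei
  ne_ej := h.ne_ej
  ne_ij := h.ne_ij
  parity_e := h.parity_e
  parity_i := h.parity_i
  parity_j := h.parity_j
  inv_ne := h.inv_ne
  rows := by simpa only [b.cartan_evenReflection h.cartan_self_ne_zero] using h.rows

theorem evenReflection_root (h : b.IsSBase e i j t) :
    (b.evenReflection e).root e = -b.root e ∧
      (b.evenReflection e).root i = b.root e + b.root i ∧
      (b.evenReflection e).root j = b.root e + b.root j := by
  obtain ⟨s, p, q, hs, -, -, ⟨h1, h2, h3⟩, -⟩ := h.rows
  refine ⟨b.evenReflection_root_self h.cartan_self_ne_zero, ?_, ?_⟩ <;>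
    simp only [BaseData.evenReflection, h1, h2, h3]
  all_goals
    have : 2 * -s / (s * 2) = -1 := by field_simp
    rw [this]
    module

theorem oddReflection_conditions (h : b.IsSBase e i j t) :
    ¬(b.cartan e i = 0 ∧ b.cartan i e = 0) ∧ ¬(b.cartan j i = 0 ∧ b.cartan i j = 0) := by
  obtain ⟨s, p, q, hs, hp, hq, ⟨-, h2, -⟩, -, ⟨-, h8, -⟩⟩ := h.rows
  rw [h2, h8]
  exact ⟨fun h0 => hs (neg_eq_zero.1 h0.1), fun h0 => hq h0.1⟩

theorem oddReflection_root (h : b.IsSBase e i j t) :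
    (b.oddReflection i).root i = -b.root i ∧
      (b.oddReflection i).root e = b.root e + b.root i ∧
      (b.oddReflection i).root j = b.root j + b.root i := by
  obtain ⟨c1, c2⟩ := h.oddReflection_conditions
  refine ⟨?_, ?_, ?_⟩ <;> simp only [BaseData.oddReflection]
  · rw [if_pos trivial]
  · rw [if_neg h.ne_ei, if_neg c1]
  · rw [if_neg h.ne_ij.symm, if_neg c2]

/-- The root αⱼ + αᵢ becomes the even simple root, while -αᵢ and αₑ + αᵢ are odd. The matrix keeps
its shape, up to row scalings, with t replaced by t/(t - 1). -/
theorem oddReflection (h : b.IsSBase e i j t) :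
    (b.oddReflection i).IsSBase j i e (t / (t - 1)) := by
  obtain ⟨c1, c2⟩ := h.oddReflection_conditions
  obtain ⟨r1, r2, r3⟩ := h.oddReflection_root
  obtain ⟨s, p, q, hs, hp, hq, ⟨h1, h2, h3⟩, ⟨h4, h5, h6⟩, ⟨h7, h8, h9⟩⟩ := h.rows
  have ht : t - 1 ≠ 0 := fun h0 => h.inv_ne 1 (by push_cast; linear_combination h0)
  have k1 : (b.oddReflection i).coroot i = b.coroot i := by
    simp only [BaseData.oddReflection]
    rw [if_pos trivial]
  have k2 : (b.oddReflection i).coroot e = (-s) • b.coroot i + (p * (-1 + t)) • b.coroot e := by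
    simp only [BaseData.oddReflection]
    rw [if_neg h.ne_ei, if_neg c1, h.parity_e, h2, h4]
    simp [superSign]
  have k3 : (b.oddReflection i).coroot j = -(q • b.coroot i + p • b.coroot j) := by
    simp only [BaseData.oddReflection]
    rw [if_neg h.ne_ij.symm, if_neg c2, h.parity_j, h8, h6]
    simp [superSign, add_comm]
  refine ⟨h.ne_ij.symm, h.ne_ej.symm, h.ne_ei.symm, ?_, ?_, ?_, fun m hm => ?_,
    -(p * q), p * (t - 1), s * p * (t - 1), neg_ne_zero.2 (mul_ne_zero hp hq), mul_ne_zero hp ht,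
    mul_ne_zero (mul_ne_zero hs hp) ht, ?_⟩
  · simp only [BaseData.oddReflection]
    rw [if_neg h.ne_ij.symm, if_neg c2, h.parity_j, h.parity_i]
    rfl
  · simp only [BaseData.oddReflection]
    rw [if_pos trivial, h.parity_i]
  · simp only [BaseData.oddReflection]
    rw [if_neg h.ne_ei, if_neg c1, h.parity_e, h.parity_i]
    rfl
  -- From tm/(t - 1) = 1 one gets t(1 - m) = 1: reciprocals of parameters change by x ↦ 1 - x, which
  -- preserves non-integrality.
  · refine h.inv_ne (1 - m) ?_
    field_simp at hm
    push_cast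
    linear_combination -hm
  · simp only [cartan] at h1 h2 h3 h4 h5 h6 h7 h8 h9
    simp only [cartan, k1, k2, k3, r1, r2, r3, LinearMap.add_apply, LinearMap.neg_apply, map_add,
      map_neg, map_smul, smul_eq_mul, h1, h2, h3, h4, h5, h6, h7, h8, h9]
    refine ⟨⟨?_, ?_, ?_⟩, ⟨?_, ?_, ?_⟩, ⟨?_, ?_, ?_⟩⟩ <;> field_simp <;> ring

end IsSBase

end BaseData

/-! ### Roots of reachable bases -/

namespace Realization

variable {α : ℂ} {H : Type*} [AddCommGroup H] [Module ℂ H] {R : Realization (cartanS α) H}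

theorem isSBase_base (hα : ∀ m : ℤ, α * m ≠ 1) : (R.base parityS).IsSBase 0 1 2 α where
  ne_ei := by decide
  ne_ej := by decide
  ne_ij := by decide
  parity_e := rfl
  parity_i := rfl
  parity_j := rfl
  inv_ne := hα
  rows := by
    refine ⟨1, 1, 1, one_ne_zero, one_ne_zero, one_ne_zero, ?_⟩
    simp [BaseData.cartan, base, R.root_coroot, cartanS]

/-- The sum of the simple roots stays equal to δ under every reflection. Hence each new simple root
is either the negative of an old one or a sum of two old ones, that is, δ minus the third, and both
operations preserve `IsAffineReal`. -/
theorem isAffineReal_of_reachable {d : H} (hd : ∀ i, R.root i d = 1) (hα : ∀ m : ℤ, α * m ≠ 1)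
    {b : BaseData 3 H} (hb : (R.base parityS).Reachable b) (k : Fin 3) :
    R.IsAffineReal d (b.root k) := by
  suffices h : (∃ e i j t, b.IsSBase e i j t ∧ b.root e + (b.root i + b.root j) = R.delta) ∧
      ∀ k, R.IsAffineReal d (b.root k) from h.2 k
  induction hb with
  | refl =>
    refine ⟨⟨0, 1, 2, α, isSBase_base hα, rfl⟩, fun k => ?_⟩
    have h0 : ∃ z : ℤ, z ≠ 0 ∧ cartanS α 0 k = z := by
      fin_cases k
      · exact ⟨2, by decide, by simp [cartanS]⟩
      · exact ⟨-1, by decide, by simp [cartanS]⟩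
      · exact ⟨-1, by decide, by simp [cartanS]⟩
    refine ⟨?_, ?_, 1, ?_⟩ <;> simp only [base, map_add, R.root_coroot]
    · fin_cases k <;> simp [cartanS]
      ring
    · exact h0
    · simp [hd]
  | even k _ hk ih =>
    obtain ⟨⟨e, i, j, t, hb, hδ⟩, hr⟩ := ih
    have hke : k = e := by
      obtain ⟨s, p, q, -, -, -, -, ⟨-, h5, -⟩, ⟨-, -, h9⟩⟩ := hb.rows
      rcases hb.cases k with rfl | rfl | rfl
      · rfl
      · exact absurd h5 hk
      · exact absurd h9 hk
    subst hke
    obtain ⟨r1, r2, r3⟩ := hb.evenReflection_root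
    refine ⟨⟨k, i, j, t, hb.evenReflection, ?_⟩, fun l => ?_⟩
    · rw [r1, r2, r3, ← hδ]; abel
    · rcases hb.cases l with rfl | rfl | rfl
      · rw [r1]; exact (hr _).neg
      · rw [r2]
        convert (hr j).delta_sub hd using 1
        rw [← hδ]; abel
      · rw [r3]
        convert (hr i).delta_sub hd using 1
        rw [← hδ]; abel
  | @odd c k _ hk _ ih =>
    obtain ⟨⟨e, i, j, t, hb, hδ⟩, hr⟩ := ih
    obtain ⟨i, j, t, hb, hδ, rfl⟩ : ∃ i j t, c.IsSBase e i j t ∧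
        c.root e + (c.root i + c.root j) = R.delta ∧ k = i := by
      rcases hb.cases k with h | h | h
      · exact absurd hk.1 (h ▸ hb.cartan_self_ne_zero)
      · exact ⟨i, j, t, hb, hδ, h⟩
      · exact ⟨j, i, -t, hb.symm, by rw [← hδ]; abel, h⟩
    obtain ⟨r1, r2, r3⟩ := hb.oddReflection_root
    refine ⟨⟨j, k, e, _, hb.oddReflection, ?_⟩, fun l => ?_⟩
    · rw [r1, r2, r3, ← hδ]; abel
    · rcases hb.cases l with rfl | rfl | rfl
      · rw [r2]
        convert (hr j).delta_sub hd using 1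
        rw [← hδ]; abel
      · rw [r1]; exact (hr _).neg
      · rw [r3]
        convert (hr e).delta_sub hd using 1
        rw [← hδ]; abel

/-! ### Integrability and the numerical conditions -/

variable {V : Type*} [AddCommGroup V] [Module ℂ V] {M : (R.contragredient parityS).Rep V}

/-- A nonzero x itself witnesses that μ is a root, and x = 0 is trivial. Thus it never has to be
shown that Y₁ or [Y₂, Y₃] survives in the quotient algebra. -/
theorem IsIntegrable.isLocallyNilpotent (hI : R.IsIntegrable parityS M) {μ : Module.Dual ℂ H}
    (hμ : μ ≠ 0) {b : BaseData 3 H} (hb : (R.base parityS).Reachable b) {i : Fin 3}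
    (hi : μ = b.root i) {x : R.Space parityS} (hx : x ∈ R.rootSpace parityS μ) :
    M.IsLocallyNilpotent x := by
  by_cases h0 : x = 0
  · exact fun v => ⟨1, one_pos, by simp [h0]⟩
  · exact hI μ ⟨⟨hμ, fun h => h0 (by rwa [h, Submodule.mem_bot] at hx)⟩, b, hb, i, Or.inl hi⟩ x hx

theorem mem_rootSpace {μ : Module.Dual ℂ H} {x : R.Space parityS}
    (h : ∀ a, (R.contragredient parityS).bracket (R.h parityS a) x = μ a • x) :
    x ∈ R.rootSpace parityS μ := by
  simp only [rootSpace, Submodule.mem_iInf, LinearMap.mem_ker, LinearMap.sub_apply,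
    LinearMap.smul_apply, LinearMap.id_apply, sub_eq_zero]
  exact h

theorem Y_mem_rootSpace (i : Fin 3) : R.Y parityS i ∈ R.rootSpace parityS (-R.root i) :=
  mem_rootSpace fun a => by rw [bracket_h_Y, LinearMap.neg_apply, neg_smul]

theorem bracket_Y_mem_rootSpace (i j : Fin 3) :
    (R.contragredient parityS).bracket (R.Y parityS i) (R.Y parityS j) ∈
      R.rootSpace parityS (-(R.root j + R.root i)) := by
  refine mem_rootSpace fun a => ?_
  rw [(R.contragredient parityS).jacobi (R.h_mem_part _ a) (R.Y_mem_part _ i) (R.Y_mem_part _ j),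
    bracket_h_Y, bracket_h_Y]
  simp [superSign]
  module

theorem act_bracket_Y_one_two : M.act ((R.contragredient parityS).bracket (R.Y parityS 1)
    (R.Y parityS 2)) = -R.lowOp M := by
  ext w
  rw [M.act_bracket (R.Y_mem_part _ 1) (R.Y_mem_part _ 2)]
  simp [superSign, parityS, lowOp, opY]

namespace IsHighestVector

variable {lam : Module.Dual ℂ H} {v : V}

theorem isIntegrable (hv : R.IsHighestVector parityS M lam v) (hα : ∀ m : ℤ, α * m ≠ 1)
    {m : ℕ} (hm : lam (R.coroot 0) = m)
    (h : (lam (R.coroot 1) = 0 ∧ lam (R.coroot 2) = 0) ∨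
      ((lam (R.coroot 1) ≠ 0 ∨ lam (R.coroot 2) ≠ 0) ∧
        ∃ m : ℕ, lam (R.coroot 1) + lam (R.coroot 2) - 1 = m)) : R.IsIntegrable parityS M := by
  obtain ⟨d, hd⟩ := R.exists_root_eq_one
  have hα1 : α ≠ 1 := fun h => hα 1 (by rw [h]; simp)
  have key : ∀ {b : BaseData 3 H}, (R.base parityS).Reachable b → ∀ i,
      R.HasBoundedStrings parityS M (b.root i) := fun hb i =>
    hv.hasBoundedStrings_of_isAffineReal hd (hv.opY_zero_locallyNilpotent hd hm)
      (hv.lowOp_locallyNilpotent hd hα1 h) (isAffineReal_of_reachable hd hα hb i)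
  rintro μ ⟨-, b, hb, i, hμ⟩ x hx
  refine hv.isLocallyNilpotent_of_hasBoundedStrings ?_ hx
  rcases hμ with rfl | hμ
  · exact key hb i
  · have h2 : μ = (2 : ℂ) • b.root i := by
      rw [← hμ, smul_smul]
      norm_num
    rw [h2]
    exact (key hb i).two_smul

/-- The even reflection at α₁ makes -α₁ a simple root, so Y₁ is locally nilpotent. -/
theorem exists_nat_of_isIntegrable (hv : R.IsHighestVector parityS M lam v)
    (hI : R.IsIntegrable parityS M) : ∃ m : ℕ, lam (R.coroot 0) = m := by
  have hk : (R.base parityS).cartan 0 0 ≠ 0 := by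
    simp [BaseData.cartan, base, R.root_coroot, cartanS]
  obtain ⟨N, -, hN⟩ := hI.isLocallyNilpotent (neg_ne_zero.2 (R.linearIndependent_root.ne_zero 0))
    (.even 0 .refl hk) (i := 0) ((BaseData.evenReflection_root_self _ hk).symm)
    (Y_mem_rootSpace 0) v
  obtain ⟨n, hn, -⟩ := (isSOps (R := R) (M := M)).isSlTwoOps_zero.exists_weight_eq_nat hv.ne_zero
    (hv.opH_eq _) (hv.opX_eq 0) ⟨N, hN⟩
  exact ⟨n, hn⟩

/-- The odd reflection at α₂ makes α₂ + α₃ simple, and the even reflection there negates it. So [Y₂,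
Y₃] is locally nilpotent, and `sl₂`-theory applies to the primitive vector Yᵢv. Using Yᵢv instead of
v is the source of the -1. -/
theorem exists_nat_of_isIntegrable_of_ne_zero (hv : R.IsHighestVector parityS M lam v)
    (hα : ∀ m : ℤ, α * m ≠ 1) (hI : R.IsIntegrable parityS M) {i : Fin 3} (hi : i ≠ 0)
    (hl : lam (R.coroot i) ≠ 0) : ∃ m : ℕ, lam (R.coroot 1) + lam (R.coroot 2) - 1 = m := by
  have hB := isSBase_base (R := R) hα
  have hk := hB.oddReflection.cartan_self_ne_zero
  have hμ : -(R.root 2 + R.root 1) ≠ 0 := by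
    intro h0
    obtain ⟨d, hd⟩ := R.exists_root_eq_one
    have := LinearMap.congr_fun h0 d
    simp [hd] at this
  have hr : -(R.root 2 + R.root 1) =
      (((R.base parityS).oddReflection 1).evenReflection 2).root 2 := by
    rw [BaseData.evenReflection_root_self _ hk, hB.oddReflection_root.2.2]
    rfl
  have hn := hI.isLocallyNilpotent hμ
    (.even 2 (.odd 1 .refl hB.isIsotropic hB.isRegular) hk) hr (bracket_Y_mem_rootSpace 1 2)
  obtain ⟨N, -, hN⟩ := hn (R.opY parityS M i v)
  rw [act_bracket_Y_one_two, neg_pow, Module.End.mul_apply] at hN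
  obtain ⟨n, hn, -⟩ := isSlTwoOps_lowOp.exists_weight_eq_nat (hv.opY_highest_ne_zero hl)
    (hv.opH_opY_highest hi) hv.raiseOp_opY_highest ⟨N, by
      rcases neg_one_pow_eq_or (Module.End ℂ V) N with h | h <;> rw [h] at hN <;> simpa using hN⟩
  exact ⟨n, hn⟩

end IsHighestVector

end Realization

theorem mainTheorem5 (α : ℂ) (hα : α ≠ 0) (hα' : ∀ m : ℤ, 1 / α ≠ (m : ℂ))
    {H : Type*} [AddCommGroup H] [Module ℂ H] (R : Realization (cartanS α) H)
    {V : Type*} [AddCommGroup V] [Module ℂ V] (M : (R.contragredient parityS).Rep V)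
    (lam : Module.Dual ℂ H) (hirr : M.IsIrreducible) (hlam : R.IsHighestWeight parityS M lam) :
    ((lam (R.coroot 1) ≠ 0 ∨ lam (R.coroot 2) ≠ 0) →
      (R.IsIntegrable parityS M ↔
        (∃ m : ℕ, lam (R.coroot 0) = (m : ℂ)) ∧
          ∃ m : ℕ, lam (R.coroot 1) + lam (R.coroot 2) - 1 = (m : ℂ))) ∧
    ((lam (R.coroot 1) = 0 ∧ lam (R.coroot 2) = 0) →
      (R.IsIntegrable parityS M ↔ ∃ m : ℕ, lam (R.coroot 0) = (m : ℂ))) := by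
  obtain ⟨v, hv⟩ := hlam.exists_isHighestVector hirr
  have hα1 : ∀ m : ℤ, α * m ≠ 1 := fun m hm => hα' m (by rw [← hm]; field_simp)
  refine ⟨fun h12 => ⟨fun hI => ⟨hv.exists_nat_of_isIntegrable hI, ?_⟩, ?_⟩,
    fun h12 => ⟨hv.exists_nat_of_isIntegrable, ?_⟩⟩
  · rcases h12 with h | h
    · exact hv.exists_nat_of_isIntegrable_of_ne_zero hα1 hI (by decide) h
    · exact hv.exists_nat_of_isIntegrable_of_ne_zero hα1 hI (by decide) h
  · rintro ⟨⟨m, hm⟩, hn⟩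
    exact hv.isIntegrable hα1 hm (Or.inr ⟨h12, hn⟩)
  · rintro ⟨m, hm⟩
    exact hv.isIntegrable hα1 hm (Or.inl h12)
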